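/- All graphs are finite and simple. A graph property is an isomorphism-closed class of graphs; it is additive if it is closed under vertex-disjoint unions, and induced-hereditary if it is closed under induced subgraphs. All properties considered contain the null graph and at least one, but not all, non-null graphs. The product $\mathcal P_1\circ\dots\circ\mathcal P_m$ is the class of graphs $G$ whose vertex set has an ordered partition $(U_1,\dots,U_m)$ (empty parts allowed) with $G[U_i]\in\mathcal P_i$ for all $i$. An additive induced-hereditary property is irreducible if it is not the product of two additive induced-hereditary properties. A graph $H$ is strongly uniquely $(\mathcal P_1,\dots,\mathcal P_m)$-partitionable, with partition $(V_1,\dots,V_m)$, if $H[V_i]\in\mathcal P_i$ for all $i$, and for every ordered partition $(U_1,\dots,U_m)$ of $V(H)$ with $H[U_i]\in\mathcal P_i$ for all $i$ there is a permutation $\phi$ of $\{1,\dots,m\}$ with $V_i=U_{\phi(i)}$ for all $i$ and with $\mathcal P_i=\mathcal P_j$ whenever $i,j$ lie in the same cycle of $\phi$. **Theorem.** Let $\mathcal A$ and $\mathcal B$ be additive induced-hereditary properties. Then there is a polynomial-time transformation (a polynomial-time computable map $G\mapsto G'$ on graphs such that $G\in\mathcal A$ if and only if $G'\in\mathcal A\circ\mathcal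 B$) from the $\mathcal A$-recognition problem to the $(\mathcal A\circ\mathcal B)$-recognition problem. More precisely, there are irreducible additive induced-hereditary properties $\mathcal P_1,\dots,\mathcal P_k$ and $\mathcal Q_1,\dots,\mathcal Q_l$ with $\mathcal A=\mathcal P_1\circ\dots\circ\mathcal P_k$ and $\mathcal B=\mathcal Q_1\circ\dots\circ\mathcal Q_l$, a fixed strongly uniquely $(\mathcal P_1,\dots,\mathcal P_k,\mathcal Q_1,\dots,\mathcal Q_l)$-partitionable graph $H$ with partition $(V_1,\dots,V_{k+l})$ into non-empty parts, and a vertex $v\in V_1\cup\dots\cup V_k$ of $H$, such that one may take for $G'$ the graph obtained from the disjoint union of $G$ and $H$ by making every vertex of $G$ adjacent to every vertex of $N_H(v)\cap(V_{k+1}\cup\dots\cup V_{k+l})$. -/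

import Mathlib

/-- A finite simple graph, on the vertex set `Fin n`. -/
structure FinGraph where
  n : ℕ
  graph : SimpleGraph (Fin n)

/-- A graph property: a class of finite simple graphs that is closed under isomorphism. -/
structure GraphProperty where
  carrier : Set FinGraph
  iso_closed : ∀ G H : FinGraph, Nonempty (G.graph ≃g H.graph) → G ∈ carrier → H ∈ carrier

namespace GraphProperty

/-- A graph on an arbitrary (finite) vertex type has property `P` if it is isomorphic to a
member of the class. -/
def Has (P : GraphProperty) {V : Type} (G : SimpleGraph V) : Prop :=
  ∃ H ∈ P.carrier, Nonempty (G ≃g H.graph)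

theorem Has.of_iso {P : GraphProperty} {V W : Type} {G : SimpleGraph V} {H : SimpleGraph W}
    (e : G ≃g H) (h : P.Has G) : P.Has H := by
  obtain ⟨K, hK, ⟨f⟩⟩ := h
  exact ⟨K, hK, ⟨e.symm.trans f⟩⟩

/-- Restriction of an isomorphism to a vertex set and its preimage. -/
def induceIso {V W : Type} {G : SimpleGraph V} {H : SimpleGraph W} (e : G ≃g H) (U : Set W) :
    G.induce (e ⁻¹' U) ≃g H.induce U where
  toEquiv := e.toEquiv.subtypeEquiv fun _ => Iff.rfl
  map_rel_iff' := by
    intro a b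
    exact e.map_rel_iff'

/-- Closed under vertex-disjoint unions. -/
def IsAdditive (P : GraphProperty) : Prop :=
  ∀ G ∈ P.carrier, ∀ H ∈ P.carrier, P.Has (G.graph ⊕g H.graph)

/-- Closed under induced subgraphs. -/
def IsInducedHereditary (P : GraphProperty) : Prop :=
  ∀ G ∈ P.carrier, ∀ U : Set (Fin G.n), P.Has (G.graph.induce U)

/-- Contains the null graph, and at least one but not all of the non-null graphs. -/
def IsNontrivial (P : GraphProperty) : Prop :=
  (⟨0, ⊥⟩ : FinGraph) ∈ P.carrier ∧
    (∃ G ∈ P.carrier, 0 < G.n) ∧ ∃ G : FinGraph, 0 < G.n ∧ G ∉ P.carrier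

/-- Additive induced-hereditary properties (nontrivial, by convention). -/
structure IsAdditiveInducedHereditary (P : GraphProperty) : Prop where
  nontrivial : P.IsNontrivial
  additive : P.IsAdditive
  inducedHereditary : P.IsInducedHereditary

/-- The product `A ∘ B`: the graphs whose vertex set can be partitioned into a part inducing
a graph in `A` and a part inducing a graph in `B` (parts may be empty). -/
def prod (A B : GraphProperty) : GraphProperty where
  carrier := {G | ∃ U : Set (Fin G.n), A.Has (G.graph.induce U) ∧ B.Has (G.graph.induce Uᶜ)}
  iso_closed := by
    rintro G H ⟨e⟩ ⟨U, hA, hB⟩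
    exact ⟨e.symm ⁻¹' U, hA.of_iso (induceIso e.symm U).symm,
      hB.of_iso (induceIso e.symm Uᶜ).symm⟩

/-- The colour classes of `c` form an ordered `(P i)`-partition of the graph `G`. -/
def IsPartition {ι V : Type} (P : ι → GraphProperty) (G : SimpleGraph V) (c : V → ι) : Prop :=
  ∀ i, (P i).Has (G.induce {v | c v = i})

/-- The product of a family of properties. -/
def prodFamily {ι : Type} (P : ι → GraphProperty) : GraphProperty where
  carrier := {G | ∃ c : Fin G.n → ι, IsPartition P G.graph c}
  iso_closed := by
    rintro G H ⟨e⟩ ⟨c, hc⟩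
    exact ⟨c ∘ e.symm, fun i => (hc i).of_iso (induceIso e.symm {v | c v = i}).symm⟩

/-- An additive induced-hereditary property that is not a product of two such properties. -/
def IsIrreducible (P : GraphProperty) : Prop :=
  P.IsAdditiveInducedHereditary ∧
    ¬ ∃ A B : GraphProperty,
      A.IsAdditiveInducedHereditary ∧ B.IsAdditiveInducedHereditary ∧ P = A.prod B

/-- `G` is strongly uniquely `(P i)`-partitionable, the partition being given by the colour
classes of `c`: every `(P i)`-partition arises from this one by a permutation `φ` of the parts,
where indices in the same cycle of `φ` carry the same property. -/
def IsStronglyUniquePartition {ι V : Type} (P : ι → GraphProperty) (G : SimpleGraph V)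
    (c : V → ι) : Prop :=
  IsPartition P G c ∧
    ∀ d : V → ι, IsPartition P G d →
      ∃ φ : Equiv.Perm ι, (∀ i, {v | c v = i} = {v | d v = φ i}) ∧
        ∀ i j, φ.SameCycle i j → P i = P j

end GraphProperty

namespace FinGraph

/-- The disjoint union of `G` and `H`, with in addition every vertex of `G` adjacent to every
vertex of `H` that lies in `S`. -/
def attachAux {V W : Type} (G : SimpleGraph V) (H : SimpleGraph W) (S : Set W) :
    SimpleGraph (V ⊕ W) where
  Adj
    | Sum.inl a, Sum.inl b => G.Adj a b
    | Sum.inr x, Sum.inr y => H.Adj x y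
    | Sum.inl _, Sum.inr y => y ∈ S
    | Sum.inr x, Sum.inl _ => x ∈ S
  symm := ⟨by
    rintro (a | x) (b | y) h
    · exact G.adj_symm h
    · exact h
    · exact h
    · exact H.adj_symm h⟩
  loopless := ⟨by
    rintro (a | x) h
    · exact G.irrefl h
    · exact H.irrefl h⟩

/-- The graph `attachAux`, with the vertices numbered: first those of `G`, then those of `H`. -/
def attach (H : FinGraph) (S : Set (Fin H.n)) (G : FinGraph) : FinGraph where
  n := G.n + H.n
  graph := (attachAux G.graph H.graph S).comap finSumFinEquiv.symm

open Classical in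
/-- The adjacency matrix as a word: row after row, each row ended by the separator `none`. -/
noncomputable def encode (G : FinGraph) : List (Option Bool) :=
  (List.finRange G.n).flatMap fun i =>
    (List.finRange G.n).map (fun j => some (decide (G.graph.Adj i j))) ++ [none]

end FinGraph

/-- `f` is a polynomial-time (many-one) transformation from the recognition problem of `P` to
that of `Q`: it is computed by a Turing machine in polynomial time, and it preserves and
reflects membership. -/
def IsPolyTimeTransformation (f : FinGraph → FinGraph) (P Q : GraphProperty) : Prop :=
  Nonempty (Turing.TM2ComputableInPolyTime FinGraph.encode FinGraph.encode f) ∧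
    ∀ G : FinGraph, G ∈ P.carrier ↔ f G ∈ Q.carrier

/-! Additive hereditary classes, with the class of the null graph as unit and the class of all
graphs allowed, form an ordered commutative monoid under the product. The core is a Riesz refinement
(`exists_refinement`): if `∏ A i ≤ ∏ B j`, there are classes `X i j` with `A i ≤ ∏ j, X i j` and `∏
i, X i j ≤ B j`. For its proof, take a finite graph `T` whose sort `i` part lies in `A i`. All its
blow-ups lie in `∏ A i`, hence in `∏ B j`. By Hales–Jewett (`IsBlowup.exists_ramsey`) a partition of
a large blow-up contains any given blow-up coloured by the vertices of `T` alone, so one colouring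
of `T` splits every blow-up. A compactness argument extends this to the disjoint union of all
members of all `A i`, and `X i j` is generated by the vertices of sort `i` and colour `j`.

Refinement gives cancellation of proper classes, by induction on the largest `n` such that the class
contains all `n`-colourable graphs. This rank is superadditive, so proper classes also factor into
irreducibles. A refinement of a product of irreducibles by itself must be a permutation whose cycles
join equal classes (`exists_perm_of_refinement`).

Hence a colouring that splits all blow-ups of all members is a permutation of the sorts, and by
compactness a finite set of members already forces this on a prescribed finite set. That prescribed
set is built from minimal forbidden graphs with a vertex removed: once its copies are coloured
correctly, a vertex attached to them suitably can only receive the colour of its own sort. Attaching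
copies cyclically to a Ramsey blow-up fixes every vertex (`exists_uniquely_partitionable`).

In the reduction, a vertex of `G` sees the `Q`-parts of `H` exactly as `v` does. If it were coloured
like a `Q`-part, `v` could be moved into that part, contradicting uniqueness. So `G` only uses the
`P`-colours (`prod_has_of_attachAux`). An explicit Turing machine attaches `H`. -/

namespace GraphProperty

/-! ### Membership in a property along isomorphisms, embeddings and disjoint unions -/

theorem ext_carrier {P Q : GraphProperty} (h : P.carrier = Q.carrier) : P = Q := by
  cases P; cases Q; cases h; rfl

section Has

variable {P : GraphProperty} {V W : Type}

theorem Has.finite {G : SimpleGraph V} (h : P.Has G) : Finite V := by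
  obtain ⟨H, -, ⟨e⟩⟩ := h
  exact Finite.of_equiv _ e.toEquiv.symm

theorem mem_iff_has {G : FinGraph} : G ∈ P.carrier ↔ P.Has G.graph :=
  ⟨fun h => ⟨G, h, ⟨SimpleGraph.Iso.refl⟩⟩, fun ⟨H, hH, ⟨e⟩⟩ => P.iso_closed H G ⟨e.symm⟩ hH⟩

theorem has_congr {G : SimpleGraph V} {H : SimpleGraph W} (e : G ≃g H) : P.Has G ↔ P.Has H :=
  ⟨Has.of_iso e, Has.of_iso e.symm⟩

/-- Every graph on a finite vertex type is isomorphic to a graph on some `Fin n`. -/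
theorem exists_finGraph_iso [Finite V] (G : SimpleGraph V) :
    ∃ F : FinGraph, Nonempty (G ≃g F.graph) := by
  obtain ⟨n, ⟨e⟩⟩ := Finite.exists_equiv_fin V
  exact ⟨⟨n, G.comap e.symm⟩, ⟨(SimpleGraph.Iso.comap e.symm G).symm⟩⟩

theorem has_induce_univ {G : SimpleGraph V} : P.Has (G.induce Set.univ) ↔ P.Has G :=
  has_congr (SimpleGraph.induceUnivIso G)

theorem IsInducedHereditary.has_of_embedding (hP : P.IsInducedHereditary) {G : SimpleGraph V}
    {H : SimpleGraph W} (f : G ↪g H) (h : P.Has H) : P.Has G := by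
  obtain ⟨K, hK, ⟨e⟩⟩ := h
  let g : G ↪g K.graph := f.trans e.toEmbedding
  refine (hP K hK (Set.range g)).of_iso ?_
  exact
    { toEquiv := (Equiv.ofInjective g g.injective).symm
      map_rel_iff' := by
        rintro ⟨_, a, rfl⟩ ⟨_, b, rfl⟩
        simp only [Equiv.ofInjective_symm_apply, SimpleGraph.comap_adj,
          Function.Embedding.subtype_apply]
        exact g.map_rel_iff'.symm }

/-- Pulling back along an adjacency-preserving and -reflecting injection. -/
theorem IsInducedHereditary.has_induce (hP : P.IsInducedHereditary) {G : SimpleGraph V}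
    {H : SimpleGraph W} {S : Set V} {T : Set W} (h : P.Has (H.induce T)) (f : V → W)
    (hf : ∀ v ∈ S, f v ∈ T) (inj : Set.InjOn f S)
    (adj : ∀ u ∈ S, ∀ v ∈ S, (G.Adj u v ↔ H.Adj (f u) (f v))) : P.Has (G.induce S) := by
  refine hP.has_of_embedding (H := H.induce T)
    { toFun := fun v => ⟨f v, hf v v.2⟩
      inj' := fun u v huv => Subtype.ext (inj u.2 v.2 (congrArg Subtype.val huv))
      map_rel_iff' := fun {u v} => (adj u u.2 v v.2).symm } h

theorem IsInducedHereditary.has_induce_mono (hP : P.IsInducedHereditary) {G : SimpleGraph V}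
    {S T : Set V} (h : P.Has (G.induce T)) (hST : S ⊆ T) : P.Has (G.induce S) :=
  hP.has_induce h id hST (Set.injOn_id _) fun _ _ _ _ => Iff.rfl

theorem IsInducedHereditary.has_of_has_induce (hP : P.IsInducedHereditary) {G : SimpleGraph V}
    {H : SimpleGraph W} {T : Set W} (h : P.Has (H.induce T)) (f : V → W)
    (hf : ∀ v, f v ∈ T) (inj : f.Injective)
    (adj : ∀ u v, (G.Adj u v ↔ H.Adj (f u) (f v))) : P.Has G :=
  has_induce_univ.1 (hP.has_induce h f (fun v _ => hf v) inj.injOn fun u _ v _ => adj u v)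

theorem IsInducedHereditary.has_of_has (hP : P.IsInducedHereditary) {G : SimpleGraph V}
    {H : SimpleGraph W} (h : P.Has H) (f : V → W) (inj : f.Injective)
    (adj : ∀ u v, (G.Adj u v ↔ H.Adj (f u) (f v))) : P.Has G :=
  hP.has_of_has_induce (has_induce_univ.2 h) f (fun _ => Set.mem_univ _) inj adj

theorem IsAdditive.has_sum (hP : P.IsAdditive) {G : SimpleGraph V} {H : SimpleGraph W}
    (hG : P.Has G) (hH : P.Has H) : P.Has (G ⊕g H) := by
  obtain ⟨K, hK, ⟨e⟩⟩ := hG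
  obtain ⟨L, hL, ⟨f⟩⟩ := hH
  refine (hP K hK L hL).of_iso ?_
  exact
    { toEquiv := Equiv.sumCongr e.toEquiv.symm f.toEquiv.symm
      map_rel_iff' := by
        rintro (a | a) (b | b)
        · exact e.symm.map_rel_iff'
        · simp
        · simp
        · exact f.symm.map_rel_iff' }

/-- A graph that splits into two parts without edges between them. -/
theorem IsAdditive.has_induce_union (hP : P.IsAdditive) (hP' : P.IsInducedHereditary)
    {G : SimpleGraph V} {S T : Set V} (hS : P.Has (G.induce S)) (hT : P.Has (G.induce T))
    (hno : ∀ u ∈ S, ∀ v ∈ T, ¬ G.Adj u v) : P.Has (G.induce (S ∪ T)) := by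
  classical
  have hmem : ∀ v : ↥(S ∪ T), (v : V) ∉ S → (v : V) ∈ T := fun v h => v.2.resolve_left h
  refine hP'.has_of_has (hP.has_sum hS hT)
    (fun v => if h : (v : V) ∈ S then Sum.inl ⟨v, h⟩ else Sum.inr ⟨v, hmem v h⟩) ?_ ?_
  · intro u v huv
    by_cases hu : (u : V) ∈ S <;> by_cases hv : (v : V) ∈ S <;> simp [hu, hv] at huv <;>
      exact Subtype.ext huv
  · intro u v
    by_cases hu : (u : V) ∈ S <;> by_cases hv : (v : V) ∈ S <;> simp [hu, hv]
    · exact hno u hu v (hmem v hv)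
    · exact fun h => hno v hv u (hmem u hu) h.symm

end Has

end GraphProperty

/-! ### The ordered commutative monoid of additive hereditary classes -/

/-- The additive induced-hereditary properties, including the degenerate ones: that of the null
graph alone and that of all graphs. -/
@[ext]
structure AddHer where
  prop : GraphProperty
  null_mem : (⟨0, ⊥⟩ : FinGraph) ∈ prop.carrier
  additive : prop.IsAdditive
  hereditary : prop.IsInducedHereditary

namespace AddHer

open GraphProperty

variable {V W ι κ : Type}

/-- Any two null graphs are isomorphic. -/
def isoOfIsEmpty [IsEmpty V] [IsEmpty W] (G : SimpleGraph V) (H : SimpleGraph W) : G ≃g H where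
  toEquiv := Equiv.equivOfIsEmpty V W
  map_rel_iff' := fun {a} => isEmptyElim a

/-- The graph `G` has property `P`. -/
def Has (P : AddHer) (G : SimpleGraph V) : Prop := P.prop.Has G

theorem has_of_isEmpty [IsEmpty V] (P : AddHer) (G : SimpleGraph V) : P.Has G :=
  ⟨_, P.null_mem, ⟨isoOfIsEmpty _ _⟩⟩

theorem has_induce_empty (P : AddHer) (G : SimpleGraph V) {S : Set V} (hS : ∀ v, v ∉ S) :
    P.Has (G.induce S) :=
  haveI : IsEmpty S := ⟨fun v => hS v v.2⟩
  P.has_of_isEmpty _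

/-- Disjoint unions of finitely many members. -/
theorem has_induce_of_fibers (P : AddHer) {G : SimpleGraph V} {S : Set V} (f : V → κ)
    (s : Finset κ) (hs : ∀ v ∈ S, f v ∈ s)
    (hno : ∀ u ∈ S, ∀ v ∈ S, G.Adj u v → f u = f v)
    (h : ∀ a ∈ s, P.Has (G.induce {v | v ∈ S ∧ f v = a})) : P.Has (G.induce S) := by
  classical
  induction s using Finset.induction_on generalizing S with
  | empty => exact P.has_induce_empty G fun v hv => by simpa using hs v hv
  | insert a s ha ih =>
    have h1 := h a (Finset.mem_insert_self a s)
    have h2 : P.Has (G.induce {v | v ∈ S ∧ f v ≠ a}) := by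
      refine ih (fun v hv => (Finset.mem_insert.1 (hs v hv.1)).resolve_left hv.2)
        (fun u hu v hv => hno u hu.1 v hv.1) fun b hb => ?_
      exact P.hereditary.has_induce_mono (h b (Finset.mem_insert_of_mem hb))
        fun v hv => ⟨hv.1.1, hv.2⟩
    have := P.additive.has_induce_union P.hereditary h1 h2
      (fun u hu v hv hadj => hv.2 ((hno u hu.1 v hv.1 hadj).symm.trans hu.2))
    refine P.hereditary.has_induce_mono this fun v hv => ?_
    by_cases hva : f v = a
    · exact Or.inl ⟨hv, hva⟩
    · exact Or.inr ⟨hv, hva⟩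

instance : PartialOrder AddHer where
  le P Q := P.prop.carrier ⊆ Q.prop.carrier
  le_refl P := subset_rfl
  le_trans _ _ _ h h' := h.trans h'
  le_antisymm P Q h h' := AddHer.ext (ext_carrier (h.antisymm h'))

theorem Has.mono {P Q : AddHer} (hPQ : P ≤ Q) {G : SimpleGraph V} (h : P.Has G) : Q.Has G := by
  obtain ⟨H, hH, e⟩ := h
  exact ⟨H, hPQ hH, e⟩

theorem le_of_has {P Q : AddHer}
    (h : ∀ n (G : SimpleGraph (Fin n)), P.Has G → Q.Has G) : P ≤ Q := fun G hG =>
  mem_iff_has.2 (h G.n G.graph (mem_iff_has.1 hG))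

theorem eq_of_has {P Q : AddHer}
    (h : ∀ n (G : SimpleGraph (Fin n)), P.Has G ↔ Q.Has G) : P = Q :=
  (le_of_has fun n G => (h n G).1).antisymm (le_of_has fun n G => (h n G).2)

theorem has_prod_iff {A B : GraphProperty} {G : SimpleGraph V} [Finite V] :
    (A.prod B).Has G ↔ ∃ U : Set V, A.Has (G.induce U) ∧ B.Has (G.induce Uᶜ) := by
  obtain ⟨F, ⟨e⟩⟩ := exists_finGraph_iso G
  rw [has_congr e, ← mem_iff_has]
  constructor
  · rintro ⟨U, hA, hB⟩
    exact ⟨e ⁻¹' U, hA.of_iso (induceIso e U).symm, hB.of_iso (induceIso e Uᶜ).symm⟩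
  · rintro ⟨U, hA, hB⟩
    exact ⟨e.symm ⁻¹' U, hA.of_iso (induceIso e.symm U).symm,
      hB.of_iso (induceIso e.symm Uᶜ).symm⟩

theorem has_prodFamily_iff {P : ι → GraphProperty} {G : SimpleGraph V} [Finite V] :
    (prodFamily P).Has G ↔ ∃ c : V → ι, IsPartition P G c := by
  obtain ⟨F, ⟨e⟩⟩ := exists_finGraph_iso G
  rw [has_congr e, ← mem_iff_has]
  constructor
  · rintro ⟨c, hc⟩
    exact ⟨c ∘ e, fun i => (hc i).of_iso (induceIso e {v | c v = i}).symm⟩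
  · rintro ⟨c, hc⟩
    exact ⟨c ∘ e.symm, fun i => (hc i).of_iso (induceIso e.symm {v | c v = i}).symm⟩

instance : One AddHer where
  one :=
    { prop :=
        { carrier := {G | G.n = 0}
          iso_closed := by
            rintro G H ⟨e⟩ (h : G.n = 0)
            have := Fintype.card_congr e.toEquiv
            simp only [Fintype.card_fin] at this
            exact this.symm.trans h }
      null_mem := rfl
      additive := by
        rintro ⟨_, G⟩ rfl ⟨_, H⟩ rfl
        exact ⟨⟨0, ⊥⟩, rfl, ⟨isoOfIsEmpty _ _⟩⟩
      hereditary := by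
        rintro ⟨_, G⟩ rfl U
        exact ⟨⟨0, ⊥⟩, rfl, ⟨isoOfIsEmpty _ _⟩⟩ }

theorem one_has_iff {G : SimpleGraph V} : (1 : AddHer).Has G ↔ IsEmpty V := by
  constructor
  · rintro ⟨⟨_, H⟩, rfl, ⟨e⟩⟩
    exact e.toEquiv.isEmpty
  · intro h
    exact has_of_isEmpty _ _

theorem one_le (P : AddHer) : 1 ≤ P := le_of_has fun n G h => by
  have := one_has_iff.1 h
  exact has_of_isEmpty _ _

theorem prod_hereditary {A B : GraphProperty} (hA : A.IsInducedHereditary)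
    (hB : B.IsInducedHereditary) : (A.prod B).IsInducedHereditary := by
  rintro G ⟨U, h1, h2⟩ S
  refine has_prod_iff.2 ⟨{v | (v : Fin G.n) ∈ U}, ?_, ?_⟩
  · exact hA.has_induce h1 Subtype.val (fun v hv => hv) Subtype.val_injective.injOn
      fun _ _ _ _ => Iff.rfl
  · exact hB.has_induce h2 Subtype.val (fun v hv => hv) Subtype.val_injective.injOn
      fun _ _ _ _ => Iff.rfl

theorem prod_additive {A B : GraphProperty} (hA : A.IsAdditive) (hB : B.IsAdditive)
    (hA' : A.IsInducedHereditary) (hB' : B.IsInducedHereditary) : (A.prod B).IsAdditive := by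
  rintro G ⟨U, h1, h2⟩ H ⟨U', h1', h2'⟩
  have key : ∀ {P : GraphProperty}, P.IsAdditive → P.IsInducedHereditary → ∀ {X : Set (Fin G.n)}
      {Y : Set (Fin H.n)}, P.Has (G.graph.induce X) → P.Has (H.graph.induce Y) →
      P.Has ((G.graph ⊕g H.graph).induce {v | Sum.elim (· ∈ X) (· ∈ Y) v}) := by
    intro P hP hP' X Y hX hY
    refine hP'.has_of_has (hP.has_sum hX hY)
      (fun v => match v with
        | ⟨Sum.inl a, ha⟩ => Sum.inl ⟨a, ha⟩
        | ⟨Sum.inr b, hb⟩ => Sum.inr ⟨b, hb⟩) ?_ ?_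
    · rintro ⟨a | a, ha⟩ ⟨b | b, hb⟩ h
      · simpa [Subtype.ext_iff] using h
      · simp at h
      · simp at h
      · simpa [Subtype.ext_iff] using h
    · rintro ⟨a | a, ha⟩ ⟨b | b, hb⟩ <;> simp
  refine has_prod_iff.2 ⟨{v | Sum.elim (· ∈ U) (· ∈ U') v}, key hA hA' h1 h1', ?_⟩
  have := key hB hB' h2 h2'
  convert this using 2
  all_goals
    ext v
    rcases v with a | a <;> simp

instance : Mul AddHer where
  mul A B :=
    { prop := A.prop.prod B.prop
      null_mem := mem_iff_has.2 <| has_prod_iff.2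
        ⟨Set.univ, A.has_induce_empty _ finZeroElim, B.has_induce_empty _ finZeroElim⟩
      additive := prod_additive A.additive B.additive A.hereditary B.hereditary
      hereditary := prod_hereditary A.hereditary B.hereditary }

theorem mul_prop (A B : AddHer) : (A * B).prop = A.prop.prod B.prop := rfl

theorem mul_has_iff {A B : AddHer} {G : SimpleGraph V} [Finite V] :
    (A * B).Has G ↔ ∃ U : Set V, A.Has (G.induce U) ∧ B.Has (G.induce Uᶜ) :=
  has_prod_iff

theorem Has.induce_of_map {P : AddHer} {G : SimpleGraph V} {H : SimpleGraph W} {S : Set V}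
    {T : Set W} (h : P.Has (H.induce T)) (f : V → W)
    (hf : ∀ v ∈ S, f v ∈ T) (inj : Set.InjOn f S)
    (adj : ∀ u ∈ S, ∀ v ∈ S, (G.Adj u v ↔ H.Adj (f u) (f v))) : P.Has (G.induce S) :=
  P.hereditary.has_induce h f hf inj adj

theorem Has.induce_mono {P : AddHer} {G : SimpleGraph V} {S T : Set V}
    (h : P.Has (G.induce T)) (hST : S ⊆ T) : P.Has (G.induce S) :=
  P.hereditary.has_induce_mono h hST

theorem Has.of_induce_of_map {P : AddHer} {G : SimpleGraph V} {H : SimpleGraph W} {T : Set W}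
    (h : P.Has (H.induce T)) (f : V → W) (hf : ∀ v, f v ∈ T) (inj : f.Injective)
    (adj : ∀ u v, (G.Adj u v ↔ H.Adj (f u) (f v))) : P.Has G :=
  P.hereditary.has_of_has_induce h f hf inj adj

theorem Has.of_map {P : AddHer} {G : SimpleGraph V} {H : SimpleGraph W}
    (h : P.Has H) (f : V → W) (inj : f.Injective)
    (adj : ∀ u v, (G.Adj u v ↔ H.Adj (f u) (f v))) : P.Has G :=
  P.hereditary.has_of_has h f inj adj

theorem mul_has_induce_iff {A B : AddHer} {G : SimpleGraph V} [Finite V] {S : Set V} :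
    (A * B).Has (G.induce S) ↔
      ∃ U ⊆ S, A.Has (G.induce U) ∧ B.Has (G.induce (S \ U)) := by
  rw [mul_has_iff]
  constructor
  · rintro ⟨U, hA, hB⟩
    refine ⟨Subtype.val '' U, by rintro _ ⟨v, -, rfl⟩; exact v.2, ?_, ?_⟩
    · classical
      refine Has.of_induce_of_map hA (fun v => ⟨v, ?_⟩) ?_ ?_ ?_
      · obtain ⟨_, w, -, rfl⟩ := v
        exact w.2
      · rintro ⟨_, w, hw, rfl⟩
        exact hw
      · intro u v h
        simpa [Subtype.ext_iff] using h
      · intro u v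
        rfl
    · refine Has.of_induce_of_map hB (fun v => ⟨v, v.2.1⟩) ?_ ?_ ?_
      · rintro ⟨v, hv, hv'⟩ h
        exact hv' ⟨_, h, rfl⟩
      · intro u v h
        simpa [Subtype.ext_iff] using h
      · intro u v
        rfl
  · rintro ⟨U, hU, hA, hB⟩
    exact ⟨{v | (v : V) ∈ U},
      hA.induce_of_map Subtype.val (fun v hv => hv) Subtype.val_injective.injOn
        fun _ _ _ _ => Iff.rfl,
      hB.induce_of_map Subtype.val (fun v hv => ⟨v.2, hv⟩) Subtype.val_injective.injOn
        fun _ _ _ _ => Iff.rfl⟩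

protected theorem mul_comm (A B : AddHer) : A * B = B * A := by
  refine eq_of_has fun n G => ?_
  rw [mul_has_iff, mul_has_iff]
  constructor <;>
  · rintro ⟨U, h1, h2⟩
    exact ⟨Uᶜ, h2, by rwa [compl_compl]⟩

protected theorem mul_assoc (A B C : AddHer) : A * B * C = A * (B * C) := by
  refine eq_of_has fun n G => ?_
  rw [mul_has_iff, mul_has_iff]
  constructor
  · rintro ⟨U, h1, h2⟩
    obtain ⟨U', hU', h3, h4⟩ := mul_has_induce_iff.1 h1
    refine ⟨U', h3, mul_has_induce_iff.2 ⟨U \ U', fun v hv => hv.2, h4,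
      h2.induce_mono fun v hv hvU => hv.2 ⟨hvU, hv.1⟩⟩⟩
  · rintro ⟨U, h1, h2⟩
    obtain ⟨U', hU', h3, h4⟩ := mul_has_induce_iff.1 h2
    refine ⟨U ∪ U', mul_has_induce_iff.2 ⟨U, Set.subset_union_left, h1, h3.induce_mono ?_⟩,
      h4.induce_mono ?_⟩
    · rintro v ⟨hv | hv, hv'⟩
      · exact absurd hv hv'
      · exact hv
    · intro v hv
      exact ⟨fun h => hv (Or.inl h), fun h => hv (Or.inr h)⟩

protected theorem one_mul (A : AddHer) : 1 * A = A := by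
  refine eq_of_has fun n G => ?_
  rw [mul_has_iff]
  constructor
  · rintro ⟨U, h1, h2⟩
    have := one_has_iff.1 h1
    refine h2.of_induce_of_map id (fun v hv => this.elim ⟨v, hv⟩) Function.injective_id
      fun _ _ => Iff.rfl
  · intro h
    exact ⟨∅, has_induce_empty _ _ (by simp), h.of_map Subtype.val Subtype.val_injective
      fun _ _ => Iff.rfl⟩

instance : CommMonoid AddHer where
  mul_assoc := AddHer.mul_assoc
  mul_comm := AddHer.mul_comm
  one_mul := AddHer.one_mul
  mul_one A := (AddHer.mul_comm A 1).trans A.one_mul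

instance : IsOrderedMonoid AddHer where
  mul_le_mul_left A B h C := le_of_has fun n G => by
    rw [mul_has_iff, mul_has_iff]
    rintro ⟨U, h1, h2⟩
    exact ⟨U, h1.mono h, h2⟩

theorem finset_prod_has_iff [DecidableEq ι] (P : ι → AddHer) (s : Finset ι) [Finite V]
    {G : SimpleGraph V} : (∏ i ∈ s, P i).Has G ↔
      ∃ c : V → ι, (∀ v, c v ∈ s) ∧ ∀ i, (P i).Has (G.induce {v | c v = i}) := by
  classical
  induction s using Finset.induction_on generalizing V with
  | empty =>
    rw [Finset.prod_empty, one_has_iff]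
    constructor
    · intro h
      exact ⟨fun v => h.elim v, fun v => h.elim v, fun i => has_of_isEmpty _ _⟩
    · rintro ⟨c, hc, -⟩
      exact ⟨fun v => by simpa using hc v⟩
  | insert a s ha ih =>
    rw [Finset.prod_insert ha, mul_has_iff]
    constructor
    · rintro ⟨U, h1, h2⟩
      obtain ⟨c, hc, hc'⟩ := ih.1 h2
      refine ⟨fun v => if h : v ∈ U then a else c ⟨v, h⟩, fun v => ?_, fun i => ?_⟩
      · by_cases h : v ∈ U
        · simp [h]
        · simp [h, hc]
      · by_cases hi : i = a
        · subst hi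
          refine h1.induce_mono fun v hv => ?_
          by_contra h
          simp only [Set.mem_ofPred_eq, h, dite_false] at hv
          exact ha (hv ▸ hc _)
        · have hU : ∀ v ∈ {v | (if h : v ∈ U then a else c ⟨v, h⟩) = i}, v ∉ U := by
            intro v hv h
            simp only [Set.mem_ofPred_eq, h, dite_true] at hv
            exact hi hv.symm
          refine (hc' i).of_induce_of_map (fun v => ⟨v, hU v v.2⟩) ?_ ?_ fun _ _ => Iff.rfl
          · rintro ⟨v, hv⟩
            have h := hU v hv
            simpa only [Set.mem_ofPred_eq, h, dite_false, not_false_eq_true] using hv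
          · intro u v h
            simpa [Subtype.ext_iff] using h
    · rintro ⟨c, hc, hc'⟩
      refine ⟨{v | c v = a}, hc' a, ih.2 ⟨fun v => c v, fun v => ?_, fun i => ?_⟩⟩
      · exact (Finset.mem_insert.1 (hc v)).resolve_left v.2
      · exact (hc' i).induce_of_map Subtype.val (fun v hv => hv) Subtype.val_injective.injOn
          fun _ _ _ _ => Iff.rfl

theorem prod_has_iff [Fintype ι] (P : ι → AddHer) [Finite V] {G : SimpleGraph V} :
    (∏ i, P i).Has G ↔ ∃ c : V → ι, ∀ i, (P i).Has (G.induce {v | c v = i}) := by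
  classical
  simp [finset_prod_has_iff]

theorem prod_prop [Fintype ι] (P : ι → AddHer) :
    (∏ i, P i).prop = prodFamily fun i => (P i).prop := by
  refine ext_carrier (Set.ext fun G => ?_)
  rw [mem_iff_has, mem_iff_has, has_prodFamily_iff]
  exact prod_has_iff P

theorem le_prod [Fintype ι] (P : ι → AddHer) (i : ι) : P i ≤ ∏ j, P j := by
  classical
  rw [← Finset.mul_prod_erase _ _ (Finset.mem_univ i)]
  calc P i = P i * 1 := (mul_one _).symm
    _ ≤ _ := mul_le_mul_right (one_le _) _

end AddHer

/-! ### Blow-ups and their Ramsey property -/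

/-- Fix a graph `T` whose vertices are sorted by `c`. A blow-up of `T` over `K` is a graph made of
`K` copies of `T`, in which the edges between vertices of different sorts are arbitrary and there
are no edges between vertices of the same sort in different copies. -/
def IsBlowup {V ι K : Type} (T : SimpleGraph V) (c : V → ι) (G : SimpleGraph (K × V)) : Prop :=
  ∀ x y, c x.2 = c y.2 → (G.Adj x y ↔ x.1 = y.1 ∧ T.Adj x.2 y.2)

namespace IsBlowup

variable {V ι K L J : Type} {T : SimpleGraph V} {c : V → ι}

/-- The blow-up with prescribed edges between vertices of different sorts. -/
def mk (T : SimpleGraph V) (c : V → ι) (r : K × V → K × V → Prop) : SimpleGraph (K × V) where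
  Adj x y := (c x.2 = c y.2 ∧ x.1 = y.1 ∧ T.Adj x.2 y.2) ∨ (c x.2 ≠ c y.2 ∧ (r x y ∨ r y x))
  symm := ⟨fun x y h => by
    rcases h with ⟨h1, h2, h3⟩ | ⟨h1, h2⟩
    · exact Or.inl ⟨h1.symm, h2.symm, h3.symm⟩
    · exact Or.inr ⟨h1.symm, h2.symm⟩⟩
  loopless := ⟨fun x h => by
    rcases h with ⟨-, -, h⟩ | ⟨h, -⟩
    · exact T.irrefl h
    · exact h rfl⟩

theorem isBlowup_mk (r : K × V → K × V → Prop) : IsBlowup T c (mk T c r) := by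
  intro x y h
  simp [mk, h]

theorem mk_adj_of_ne {r : K × V → K × V → Prop} {x y : K × V} (h : c x.2 ≠ c y.2) :
    (mk T c r).Adj x y ↔ r x y ∨ r y x := by
  simp [mk, h]

/-- Within one sort there are no edges between different copies, so additivity suffices, whatever
edges run between sorts. This places every blow-up of `T` in the product of the classes of its
sorts. -/
theorem has_sort [Finite K] {P : AddHer} {G : SimpleGraph (K × V)}
    (hG : IsBlowup T c G) {i : ι} (hP : P.Has (T.induce {v | c v = i})) :
    P.Has (G.induce {x | c x.2 = i}) := by
  have := Fintype.ofFinite K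
  refine P.has_induce_of_fibers Prod.fst Finset.univ (fun _ _ => Finset.mem_univ _) ?_ ?_
  · intro u hu v hv h
    exact ((hG u v (hu.trans hv.symm)).1 h).1
  · intro a _
    refine hP.induce_of_map Prod.snd (fun v hv => hv.1) ?_ ?_
    · exact fun u hu v hv h => Prod.ext (hu.2.trans hv.2.symm) h
    · rintro u ⟨hu, hu'⟩ v ⟨hv, hv'⟩
      rw [hG u v (hu.trans hv.symm), hu', hv']
      simp

/-- A graph mapped injectively to `K × V` so that it looks like a part of a blow-up is an induced
subgraph of a blow-up. -/
theorem exists_extension {W : Type} (G : SimpleGraph W) (f : W → K × V) (hf : f.Injective)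
    (h : ∀ x y, c (f x).2 = c (f y).2 → (G.Adj x y ↔ (f x).1 = (f y).1 ∧ T.Adj (f x).2 (f y).2)) :
    ∃ G' : SimpleGraph (K × V), IsBlowup T c G' ∧ ∀ x y, G.Adj x y ↔ G'.Adj (f x) (f y) := by
  refine ⟨mk T c fun x y => ∃ u v, f u = x ∧ f v = y ∧ G.Adj u v, isBlowup_mk _, fun x y => ?_⟩
  by_cases hc : c (f x).2 = c (f y).2
  · rw [h x y hc, isBlowup_mk _ _ _ hc]
  · rw [mk_adj_of_ne hc]
    constructor
    · exact fun hxy => Or.inl ⟨x, y, rfl, rfl, hxy⟩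
    · rintro (⟨u, v, hu, hv, huv⟩ | ⟨u, v, hu, hv, huv⟩)
      · rwa [hf hu, hf hv] at huv
      · rw [hf hu, hf hv] at huv
        exact huv.symm

/-- Vertex-Ramsey property of blow-ups. -/
theorem exists_ramsey [Finite V] [Finite ι] [Finite K] [Finite J] {G : SimpleGraph (K × V)}
    (hG : IsBlowup T c G) : ∃ (n : ℕ) (G' : SimpleGraph (Fin n × V)), IsBlowup T c G' ∧
      ∀ d : Fin n × V → J, ∃ (e : V → J) (h : K × ι → Fin n), h.Injective ∧
        (∀ a t, d (h (a, c t), t) = e t) ∧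
        ∀ a t b t', (G.Adj (a, t) (b, t') ↔ G'.Adj (h (a, c t), t) (h (b, c t'), t')) := by
  -- Hales–Jewett with letters (copy of `G`, sort); the colour of a word is the whole colour pattern
  -- of the copy of `T` indexed by that word. Vertices of different sorts are joined if some
  -- coordinate names their own sorts and copies adjacent in `G`.
  obtain ⟨N, hN, hHJ⟩ := Combinatorics.Line.exists_mono_in_high_dimension (K × ι) (V → J)
  obtain ⟨n, ⟨φ⟩⟩ := Finite.exists_equiv_fin (N → K × ι)
  refine ⟨n, mk T c fun x y => ∃ s, (φ.symm x.1 s).2 = c x.2 ∧ (φ.symm y.1 s).2 = c y.2 ∧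
    G.Adj ((φ.symm x.1 s).1, x.2) ((φ.symm y.1 s).1, y.2), isBlowup_mk _, fun d => ?_⟩
  obtain ⟨l, e, he⟩ := hHJ fun w t => d (φ w, t)
  have hinj : Function.Injective fun b : K × ι => φ (l b) := by
    intro b b' hb
    obtain ⟨s, hs⟩ := l.proper
    have := congrFun (φ.injective hb) s
    simpa [hs] using this
  -- The vertex `(a, t)` of `G` goes to the copy given by the point `(a, c t)` of the monochromatic
  -- line.
  refine ⟨e, fun b => φ (l b), hinj, fun a t => congrFun (he _) t, fun a t b t' => ?_⟩
  by_cases hc : c t = c t'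
  · rw [hG _ _ hc, isBlowup_mk _ _ _ hc]
    simp only [and_congr_left_iff]
    intro _
    rw [hinj.eq_iff, Prod.ext_iff]
    simp [hc]
  · rw [mk_adj_of_ne hc]
    -- At a constant coordinate both words show the same letter, which cannot name two different
    -- sorts. Only active coordinates count, and they reproduce the adjacency of `G`.
    have key : ∀ {a b t t'}, c t ≠ c t' →
        ((∃ s, (l (a, c t) s).2 = c t ∧ (l (b, c t') s).2 = c t' ∧
          G.Adj ((l (a, c t) s).1, t) ((l (b, c t') s).1, t')) ↔ G.Adj (a, t) (b, t')) := by
      intro a b t t' hc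
      constructor
      · rintro ⟨s, h1, h2, h3⟩
        cases hs : l.idxFun s with
        | none => simpa [hs] using h3
        | some y =>
          simp only [Combinatorics.Line.coe_apply, hs, Option.getD_some] at h1 h2
          exact absurd (h1.symm.trans h2) hc
      · intro h
        obtain ⟨s, hs⟩ := l.proper
        exact ⟨s, by simpa [hs] using h⟩
    simp only [Equiv.symm_apply_apply]
    rw [key hc, key (Ne.symm hc), SimpleGraph.adj_comm G (b, t'), or_self]

end IsBlowup

/-! ### Colourings that split every blow-up -/

/-- The colouring `e` splits every blow-up of `T` into graphs from the classes `B j`. -/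
def SplitsBlowups {V ι J : Type} (T : SimpleGraph V) (c : V → ι) (B : J → AddHer) (e : V → J) :
    Prop :=
  ∀ (k : ℕ) (G : SimpleGraph (Fin k × V)), IsBlowup T c G →
    ∀ j, (B j).Has (G.induce {x | e x.2 = j})

namespace SplitsBlowups

variable {V W ι J : Type} {T : SimpleGraph V} {c : V → ι} {B : J → AddHer} {e : V → J}

theorem has {K : Type} [Finite K] (he : SplitsBlowups T c B e) {G : SimpleGraph (K × V)}
    (hG : IsBlowup T c G) (j : J) : (B j).Has (G.induce {x | e x.2 = j}) := by
  obtain ⟨k, ⟨φ⟩⟩ := Finite.exists_equiv_fin K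
  have h := he k (G.comap fun x => (φ.symm x.1, x.2)) (fun x y hxy => by
    rw [SimpleGraph.comap_adj, hG _ _ hxy, φ.symm.injective.eq_iff]) j
  refine h.induce_of_map (fun x => (φ x.1, x.2)) (fun _ hx => hx) (fun x _ y _ hxy => ?_)
    fun x _ y _ => by simp
  simpa [Prod.ext_iff] using hxy

theorem comp {U : SimpleGraph W} (f : W → V) (hf : f.Injective)
    (hU : ∀ x y, U.Adj x y ↔ T.Adj (f x) (f y)) (he : SplitsBlowups T c B e) :
    SplitsBlowups U (c ∘ f) B (e ∘ f) := by
  intro k G hG j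
  have hf' : Function.Injective fun x : Fin k × W => (x.1, f x.2) := by
    rintro ⟨a, x⟩ ⟨b, y⟩ h
    simpa [hf.eq_iff] using h
  obtain ⟨G', hG', h⟩ := IsBlowup.exists_extension (T := T) (c := c) G
    (fun x => (x.1, f x.2)) hf' (fun x y hxy => by rw [hG x y hxy, hU])
  exact (he.has hG' j).induce_of_map _ (fun x hx => hx) hf'.injOn fun x _ y _ => h x y

/-- A single blow-up on which all colourings fail that do not split every blow-up. -/
theorem exists_universal_blowup [Finite V] [Finite J] (T : SimpleGraph V) (c : V → ι)
    (B : J → AddHer) : ∃ (n : ℕ) (G : SimpleGraph (Fin n × V)), IsBlowup T c G ∧ 0 < n ∧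
      ∀ e : V → J, (∀ j, (B j).Has (G.induce {x | e x.2 = j})) → SplitsBlowups T c B e := by
  classical
  have hbad : ∀ e : V → J, ∃ (k : ℕ) (G : SimpleGraph (Fin k × V)), IsBlowup T c G ∧
      ((∀ j, (B j).Has (G.induce {x | e x.2 = j})) → SplitsBlowups T c B e) := by
    intro e
    by_cases h : SplitsBlowups T c B e
    · exact ⟨0, IsBlowup.mk T c fun _ _ => False, IsBlowup.isBlowup_mk _, fun _ => h⟩
    · have h' := h
      unfold SplitsBlowups at h'
      push Not at h'
      obtain ⟨k, G, hG, j, hj⟩ := h'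
      exact ⟨k, G, hG, fun h => absurd (h j) hj⟩
  choose k G hG hbad using hbad
  -- The universal blow-up places the counterexamples for all colourings side by side; `none` adds
  -- one spare copy, so that the number of copies is positive.
  obtain ⟨n, ⟨φ⟩⟩ := Finite.exists_equiv_fin (Option (Σ e : V → J, Fin (k e)))
  let f : (Σ e : V → J, Fin (k e) × V) → Fin n × V := fun x => (φ (some ⟨x.1, x.2.1⟩), x.2.2)
  have hf : f.Injective := by
    rintro ⟨e, a, x⟩ ⟨e', a', x'⟩ h
    simp only [f, Prod.mk.injEq, EmbeddingLike.apply_eq_iff_eq, Option.some.injEq,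
      Sigma.mk.inj_iff] at h
    obtain ⟨⟨rfl, h⟩, rfl⟩ := h
    cases h
    rfl
  let r : Fin n × V → Fin n × V → Prop := fun x y =>
    ∃ (e : V → J) (u v : Fin (k e) × V), f ⟨e, u⟩ = x ∧ f ⟨e, v⟩ = y ∧ (G e).Adj u v
  have hr : ∀ (e : V → J) (u v : Fin (k e) × V), r (f ⟨e, u⟩) (f ⟨e, v⟩) ↔ (G e).Adj u v := by
    intro e u v
    constructor
    · rintro ⟨e', u', v', hu, hv, h⟩
      cases hf hu
      cases hf hv
      exact h
    · intro h
      exact ⟨e, u, v, rfl, rfl, h⟩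
  refine ⟨n, IsBlowup.mk T c r, IsBlowup.isBlowup_mk _, Fin.pos (φ none),
    fun e he => hbad e fun j => ?_⟩
  refine (he j).induce_of_map (fun x => f ⟨e, x⟩) (fun x hx => hx) ?_ ?_
  · intro x _ y _ hxy
    simpa using hf hxy
  · intro x _ y _
    by_cases hc : c x.2 = c y.2
    · have hc' : c (f ⟨e, x⟩).2 = c (f ⟨e, y⟩).2 := hc
      rw [hG e x y hc, IsBlowup.isBlowup_mk _ _ _ hc']
      simp [f]
    · have hc' : c (f ⟨e, x⟩).2 ≠ c (f ⟨e, y⟩).2 := hc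
      rw [IsBlowup.mk_adj_of_ne hc', hr, hr, SimpleGraph.adj_comm _ y, or_self]

/-- A Ramsey blow-up for the universal blow-up lies in `∏ A i`, hence has a partition into the
classes `B j`. On some copy of the universal blow-up this partition depends only on the vertex of
`T`, and a colouring that survives there splits every blow-up. -/
theorem exists_of_prod_le [Finite V] [Fintype ι] [Fintype J] {A : ι → AddHer}
    (hT : ∀ i, (A i).Has (T.induce {v | c v = i})) (hAB : ∏ i, A i ≤ ∏ j, B j) :
    ∃ e, SplitsBlowups T c B e := by
  obtain ⟨k, G, hG, -, hB⟩ := exists_universal_blowup T c B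
  obtain ⟨n, G', hG', hd⟩ := hG.exists_ramsey (J := J)
  have h1 : (∏ i, A i).Has G' :=
    (AddHer.prod_has_iff A).2 ⟨fun x => c x.2, fun i => hG'.has_sort (hT i)⟩
  obtain ⟨d, hd'⟩ := (AddHer.prod_has_iff B).1 (h1.mono hAB)
  obtain ⟨e, h, hinj, he, hadj⟩ := hd d
  refine ⟨e, hB e fun j => ?_⟩
  refine (hd' j).induce_of_map (fun x => (h (x.1, c x.2), x.2)) (fun x hx => (he _ _).trans hx) ?_
    fun x _ y _ => hadj _ _ _ _
  rintro ⟨a, x⟩ - ⟨b, y⟩ - hxy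
  simp only [Prod.mk.injEq, hinj.eq_iff] at hxy
  obtain ⟨⟨rfl, -⟩, rfl⟩ := hxy
  rfl

end SplitsBlowups

namespace AddHer

open GraphProperty

variable {V W ι J : Type}

/-! ### Classes generated by a vertex set of a graph -/

section Copies

variable (T : SimpleGraph V) (Z : Set V)

/-- `G` embeds into a disjoint union of copies of `T[Z]`. -/
def EmbedsInCopies (G : SimpleGraph W) : Prop :=
  ∃ f : W → ℕ × V, f.Injective ∧ (∀ v, (f v).2 ∈ Z) ∧
    ∀ u v, G.Adj u v ↔ (f u).1 = (f v).1 ∧ T.Adj (f u).2 (f v).2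

variable {T Z}

theorem EmbedsInCopies.comap {U : Type} {G : SimpleGraph W} {H : SimpleGraph U}
    (h : EmbedsInCopies T Z H) (g : G ↪g H) : EmbedsInCopies T Z G := by
  obtain ⟨f, hf, hZ, hadj⟩ := h
  exact ⟨f ∘ g, hf.comp g.injective, fun v => hZ _, fun u v =>
    (g.map_adj_iff (v := u) (w := v)).symm.trans (hadj _ _)⟩

theorem EmbedsInCopies.sum {U : Type} {G : SimpleGraph W} {H : SimpleGraph U}
    (hG : EmbedsInCopies T Z G) (hH : EmbedsInCopies T Z H) : EmbedsInCopies T Z (G ⊕g H) := by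
  obtain ⟨f, hf, hZ, hadj⟩ := hG
  obtain ⟨f', hf', hZ', hadj'⟩ := hH
  refine ⟨Sum.elim (fun v => (2 * (f v).1, (f v).2)) fun v => (2 * (f' v).1 + 1, (f' v).2),
    ?_, ?_, ?_⟩
  · rintro (u | u) (v | v) h <;> simp only [Sum.elim_inl, Sum.elim_inr, Prod.mk.injEq] at h
    · exact congrArg Sum.inl (hf (Prod.ext (by omega) h.2))
    · omega
    · omega
    · exact congrArg Sum.inr (hf' (Prod.ext (by omega) h.2))
  · rintro (v | v)
    · exact hZ v
    · exact hZ' v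
  · rintro (u | u) (v | v)
    · simp [hadj]
    · simp; omega
    · simp; omega
    · simp [hadj']

variable (T Z)

/-- The graphs that embed into a disjoint union of copies of `T[Z]`. -/
def copies : AddHer where
  prop :=
    { carrier := {G | EmbedsInCopies T Z G.graph}
      iso_closed := fun _ _ ⟨e⟩ h => EmbedsInCopies.comap h e.symm.toEmbedding }
  null_mem := ⟨finZeroElim, fun v => v.elim0, fun v => v.elim0, fun v => v.elim0⟩
  additive := fun G hG H hH => by
    obtain ⟨F, ⟨e⟩⟩ := exists_finGraph_iso (G.graph ⊕g H.graph)
    exact ⟨F, (EmbedsInCopies.sum hG hH).comap e.symm.toEmbedding, ⟨e⟩⟩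
  hereditary := fun G hG U => by
    obtain ⟨F, ⟨e⟩⟩ := exists_finGraph_iso (G.graph.induce U)
    exact ⟨F, EmbedsInCopies.comap hG (e.symm.toEmbedding.trans (SimpleGraph.Embedding.induce U)),
      ⟨e⟩⟩

variable {T Z}

theorem copies_has_iff [Finite W] {G : SimpleGraph W} :
    (copies T Z).Has G ↔ EmbedsInCopies T Z G := by
  obtain ⟨F, ⟨e⟩⟩ := exists_finGraph_iso G
  constructor
  · rintro ⟨F, hF, ⟨e⟩⟩
    exact EmbedsInCopies.comap hF e.toEmbedding
  · intro h
    exact ⟨F, h.comap e.symm.toEmbedding, ⟨e⟩⟩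

/-- A vertex of `Z` alone is a non-null member. Applied to a refinement, this turns a trivial entry
into a colour that is not used on a sort. -/
theorem eq_empty_of_copies_eq_one (h : copies T Z = 1) (z : V) : z ∉ Z := by
  intro hz
  have : (copies T Z).Has (⊥ : SimpleGraph Unit) :=
    copies_has_iff.2 ⟨fun _ => (0, z), fun _ _ _ => rfl, fun _ => hz, fun _ _ => by simp⟩
  rw [h, one_has_iff] at this
  exact this.elim ()

end Copies

/-! ### The union of all members, and compactness -/

section Member

/-- The vertices of the members of the classes `A i`, given by the sort `i`, a graph in `A i` and
the number of a vertex. -/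
def Member (A : ι → AddHer) : Type :=
  {x : ι × FinGraph × ℕ // x.2.1 ∈ (A x.1).prop.carrier ∧ x.2.2 < x.2.1.n}

variable {A : ι → AddHer}

/-- The index `i` of a vertex of a member of `A i`. -/
def Member.sort (x : Member A) : ι := x.1.1

/-- The vertex of a member of `A i` given by a vertex of a graph in `A i`. -/
def Member.ofVertex (i : ι) {n : ℕ} (G : SimpleGraph (Fin n)) (hG : (A i).Has G) (a : Fin n) :
    Member A :=
  ⟨(i, ⟨n, G⟩, a), mem_iff_has.2 hG, a.2⟩

variable (A) in
/-- The disjoint union of all members of all classes `A i`. -/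
def memberGraph : SimpleGraph (Member A) where
  Adj x y := x.1.1 = y.1.1 ∧ x.1.2.1 = y.1.2.1 ∧
    ∃ (h : x.1.2.2 < x.1.2.1.n) (h' : y.1.2.2 < x.1.2.1.n), x.1.2.1.graph.Adj ⟨_, h⟩ ⟨_, h'⟩
  symm := ⟨by
    rintro ⟨⟨i, F, a⟩, hx⟩ ⟨⟨j, F', b⟩, hy⟩ ⟨h1, h2, h, h', hadj⟩
    dsimp only at h1 h2
    subst h1 h2
    exact ⟨rfl, rfl, h', h, hadj.symm⟩⟩
  loopless := ⟨fun x ⟨_, _, _, _, h⟩ => SimpleGraph.irrefl _ h⟩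

theorem Member.ofVertex_adj {i : ι} {n : ℕ} {G : SimpleGraph (Fin n)} {hG : (A i).Has G}
    {a b : Fin n} : (memberGraph A).Adj (ofVertex i G hG a) (ofVertex i G hG b) ↔ G.Adj a b :=
  ⟨fun ⟨_, _, _, _, h⟩ => h, fun h => ⟨rfl, rfl, a.2, b.2, h⟩⟩

theorem Member.ofVertex_injective {i : ι} {n : ℕ} {G : SimpleGraph (Fin n)} {hG : (A i).Has G} :
    Function.Injective (ofVertex i G hG) := fun a b h => by
  have := congrArg (fun x : Member A => x.1.2.2) h
  exact Fin.ext this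

/-- Such a set meets finitely many members of `A i`, each in an induced subgraph, with no edges
between different members. -/
theorem memberGraph_has_sort (S : Finset (Member A)) (i : ι) :
    (A i).Has ((memberGraph A).induce {x | x ∈ S ∧ x.sort = i}) := by
  classical
  refine (A i).has_induce_of_fibers (fun x => x.1.2.1) (S.image fun x => x.1.2.1)
    (fun v hv => Finset.mem_image_of_mem _ hv.1) (fun u _ v _ h => h.2.1) fun F _ => ?_
  by_cases hF : F ∈ (A i).prop.carrier
  · have hlt : ∀ v : ↥{v : Member A | v ∈ {x | x ∈ S ∧ x.sort = i} ∧ v.1.2.1 = F},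
        v.1.1.2.2 < F.n := by
      rintro ⟨v, -, rfl⟩
      exact v.2.2
    have hF' : (A i).Has F.graph := mem_iff_has.1 hF
    refine hF'.of_map (fun v => ⟨v.1.1.2.2, hlt v⟩) ?_ ?_
    · intro u v h
      have h1 : u.1.1.1 = v.1.1.1 := u.2.1.2.trans v.2.1.2.symm
      have h2 : u.1.1.2.1 = v.1.1.2.1 := u.2.2.trans v.2.2.symm
      exact Subtype.ext (Subtype.ext (Prod.ext h1 (Prod.ext h2 (congrArg Fin.val h))))
    · rintro ⟨⟨⟨i, F, a⟩, ha⟩, ⟨-, rfl⟩, rfl⟩ ⟨⟨⟨j, F', b⟩, hb⟩, ⟨-, h1⟩, h2⟩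
      dsimp only [Member.sort] at h1 h2
      subst h1 h2
      exact ⟨fun ⟨_, _, _, _, h⟩ => h, fun h => ⟨rfl, rfl, ha.2, hb.2, h⟩⟩
  · refine has_induce_empty _ _ ?_
    rintro ⟨⟨i, F, a⟩, ha⟩ ⟨⟨-, rfl⟩, rfl⟩
    exact hF ha.1

/-- A colouring of the vertices of the members of the classes `A i` whose restriction to every
finite set of vertices splits all blow-ups. -/
def SplitsMembers {B : J → AddHer} (χ : Member A → J) : Prop :=
  ∀ S : Finset (Member A), SplitsBlowups ((memberGraph A).induce (S : Set (Member A)))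
    (fun x => x.1.sort) B fun x => χ x

theorem exists_splitsBlowups_member [Fintype ι] [Fintype J] {B : J → AddHer}
    (hAB : ∏ i, A i ≤ ∏ j, B j) (S : Finset (Member A)) :
    ∃ e, SplitsBlowups ((memberGraph A).induce (S : Set (Member A)))
      (fun x => x.1.sort) B e :=
  SplitsBlowups.exists_of_prod_le (fun i => (memberGraph_has_sort S i).induce_of_map Subtype.val
    (fun x hx => ⟨x.2, hx⟩) Subtype.val_injective.injOn fun _ _ _ _ => Iff.rfl) hAB

/-- Compactness: colourings of arbitrarily large finite sets of vertices that split the blow-ups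
converge to a colouring of all vertices. -/
theorem exists_limit [Finite J] {B : J → AddHer} (g : Finset (Member A) → Member A → J)
    (hg : ∀ S : Finset (Member A), SplitsBlowups ((memberGraph A).induce (S : Set (Member A)))
      (fun x => x.1.sort) B fun x => g S x) :
    ∃ χ : Member A → J, SplitsMembers (B := B) χ ∧
      ∀ S : Finset (Member A), ∃ S', S ⊆ S' ∧ ∀ x ∈ S, χ x = g S' x := by
  obtain ⟨χ, hχ⟩ := Finset.rado_selection g
  refine ⟨χ, fun S => ?_, hχ⟩
  obtain ⟨S', hS, h⟩ := hχ S
  have heq : (fun x : (S : Set (Member A)) => χ x.1) = fun x => g S' x.1 :=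
    funext fun x => h x.1 x.2
  rw [heq]
  exact (hg S').comp (U := (memberGraph A).induce (S : Set (Member A)))
    (fun x => ⟨x.1, hS x.2⟩) (fun x y hxy => Subtype.ext (congrArg (fun z => z.1) hxy))
    fun _ _ => Iff.rfl

/-- The graphs that occur in colour `j` in the members of `A i`. -/
def colorClass (χ : Member A → J) (i : ι) (j : J) : AddHer :=
  copies (memberGraph A) {x | x.sort = i ∧ χ x = j}

theorem le_prod_colorClass [Fintype J] (χ : Member A → J) (i : ι) :
    A i ≤ ∏ j, colorClass χ i j := le_of_has fun n G hG => by
  refine (prod_has_iff _).2 ⟨fun a => χ (Member.ofVertex i G hG a), fun j => ?_⟩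
  refine copies_has_iff.2 ⟨fun a => (0, Member.ofVertex i G hG a), ?_, fun a => ⟨rfl, a.2⟩, ?_⟩
  · intro a b h
    exact Subtype.ext (Member.ofVertex_injective (hG := hG) (Prod.ext_iff.1 h).2)
  · intro a b
    simp [Member.ofVertex_adj]

/-- The parts of a graph in the product embed into disjoint copies of the members, and the sort of
the image tells the part. Since edges between sorts are free in a blow-up, the whole graph embeds
into a blow-up over finitely many member vertices, all of colour `j`, and `χ` splits this blow-up.
-/
theorem prod_colorClass_le [Fintype ι] {B : J → AddHer} {χ : Member A → J}
    (hχ : SplitsMembers (B := B) χ) (j : J) : ∏ i, colorClass χ i j ≤ B j :=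
  le_of_has fun n G hG => by
  classical
  obtain ⟨d, hd⟩ := (prod_has_iff _).1 hG
  choose f hf hZ hadj using fun i => copies_has_iff.1 (hd i)
  let g : Fin n → ℕ × Member A := fun v => f (d v) ⟨v, rfl⟩
  have hg : ∀ i v (h : d v = i), g v = f i ⟨v, h⟩ := by
    rintro _ v rfl
    rfl
  have hsort : ∀ v, (g v).2.sort = d v := fun v => (hZ _ _).1
  have hinj : g.Injective := by
    intro u v h
    have huv : d u = d v := by rw [← hsort, h, hsort]
    rw [hg _ u huv, hg _ v rfl] at h
    simpa using hf _ h
  let S : Finset (Member A) := Finset.univ.image fun v => (g v).2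
  let K : Finset ℕ := Finset.univ.image fun v => (g v).1
  let g' : Fin n → K × (S : Set (Member A)) := fun v =>
    (⟨(g v).1, Finset.mem_image_of_mem (fun v => (g v).1) (Finset.mem_univ v)⟩,
      ⟨(g v).2, Finset.mem_image_of_mem (fun v => (g v).2) (Finset.mem_univ v)⟩)
  have hg'inj : g'.Injective := by
    intro u v h
    refine hinj (Prod.ext ?_ ?_)
    · exact congrArg (fun x => (x.1 : ℕ)) h
    · exact congrArg (fun x => (x.2 : Member A)) h
  obtain ⟨G', hG', h⟩ := IsBlowup.exists_extension
    (T := (memberGraph A).induce (S : Set (Member A))) (c := fun x => x.1.sort) G g' hg'inj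
    (fun u v huv => by
      have huv : d u = d v := by
        rw [← hsort, ← hsort]
        exact huv
      have := hadj (d v) ⟨u, huv⟩ ⟨v, rfl⟩
      rw [← hg, ← hg] at this
      simpa [g'] using this)
  exact ((hχ S).has hG' j).of_induce_of_map g' (fun v => (hZ _ _).2) hg'inj h

end Member

/-! ### Refinement, rank and cancellation -/

/-- Riesz refinement for the product of classes. -/
theorem exists_refinement [Fintype ι] [Fintype J] {A : ι → AddHer} {B : J → AddHer}
    (hAB : ∏ i, A i ≤ ∏ j, B j) :
    ∃ X : ι → J → AddHer, (∀ i, A i ≤ ∏ j, X i j) ∧ ∀ j, ∏ i, X i j ≤ B j := by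
  classical
  by_cases hJ : Nonempty J
  · have : ∀ S : Finset (Member A), ∃ e : Member A → J,
        SplitsBlowups ((memberGraph A).induce (S : Set (Member A)))
          (fun x => x.1.sort) B fun x => e x := by
      intro S
      obtain ⟨e, he⟩ := exists_splitsBlowups_member hAB S
      exact ⟨fun x => if h : x ∈ S then e ⟨x, h⟩ else hJ.some, by simpa using he⟩
    choose g hg using this
    obtain ⟨χ, hχ, -⟩ := exists_limit g hg
    exact ⟨colorClass χ, le_prod_colorClass χ, prod_colorClass_le hχ⟩
  -- Without colours the right-hand product is `1`, so every `A i` is trivial.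
  · have := not_nonempty_iff.1 hJ
    refine ⟨fun _ => isEmptyElim, fun i => ?_, isEmptyElim⟩
    simpa using (le_prod A i).trans hAB

section Rank

/-- Some graph is not in `P`. -/
def IsProper (P : AddHer) : Prop := ∃ n, ∃ G : SimpleGraph (Fin n), ¬ P.Has G

theorem IsProper.anti {P Q : AddHer} (hQ : Q.IsProper) (h : P ≤ Q) : P.IsProper := by
  obtain ⟨n, G, hG⟩ := hQ
  exact ⟨n, G, fun h' => hG (h'.mono h)⟩

/-- All `n`-colourable graphs are in `P`. -/
def HasColorable (P : AddHer) (n : ℕ) : Prop :=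
  ∀ m (G : SimpleGraph (Fin m)), G.Colorable n → P.Has G

theorem HasColorable.has [Finite V] {P : AddHer} {n : ℕ} (h : P.HasColorable n)
    {G : SimpleGraph V} (hG : G.Colorable n) : P.Has G := by
  obtain ⟨F, ⟨e⟩⟩ := exists_finGraph_iso G
  exact (h _ F.graph (hG.of_hom e.symm.toHom)).of_iso e.symm

theorem hasColorable_zero (P : AddHer) : P.HasColorable 0 := fun m G hG => by
  have := SimpleGraph.colorable_zero_iff.1 hG
  exact P.has_of_isEmpty G

/-- Heredity yields a one-vertex graph from any non-null member, and additivity then yields all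
edgeless graphs. -/
theorem hasColorable_one {P : AddHer} (h : P ≠ 1) : P.HasColorable 1 := by
  obtain ⟨n, G, hG, hn⟩ : ∃ n, ∃ G : SimpleGraph (Fin n), P.Has G ∧ ¬ IsEmpty (Fin n) := by
    by_contra! hcon
    exact h (eq_of_has fun n G => ⟨fun hG => one_has_iff.2 (hcon n G hG), Has.mono (one_le P)⟩)
  rw [not_isEmpty_iff] at hn
  obtain ⟨a⟩ := hn
  intro m G' ⟨C⟩
  have hno : ∀ u v, ¬ G'.Adj u v := fun u v huv => C.valid huv (Subsingleton.elim _ _)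
  refine has_induce_univ.1 (P.has_induce_of_fibers id Finset.univ (by simp) (fun u _ v _ h =>
    absurd h (hno u v)) fun b _ => ?_)
  refine Has.induce_of_map (T := Set.univ) (has_induce_univ.2 hG) (fun _ => a)
    (fun _ _ => Set.mem_univ _) ?_ ?_
  · intro u hu v hv _
    exact hu.2.trans hv.2.symm
  · intro u _ v _
    simp [hno]

theorem HasColorable.mul {P Q : AddHer} {a b : ℕ} (hP : P.HasColorable a)
    (hQ : Q.HasColorable b) : (P * Q).HasColorable (a + b) := by
  rintro m G ⟨C⟩
  refine mul_has_iff.2 ⟨{v | (C v : ℕ) < a}, hP.has ⟨SimpleGraph.Coloring.mk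
    (fun v => ⟨(C v.1 : ℕ), v.2⟩) ?_⟩, hQ.has ⟨SimpleGraph.Coloring.mk
    (fun v => ⟨(C v.1 : ℕ) - a, ?_⟩) ?_⟩⟩
  · intro u v h h'
    refine C.valid h (Fin.ext ?_)
    simpa using h'
  · have := (C v.1).2
    have := v.2
    simp only [Set.mem_compl_iff, Set.mem_ofPred_eq] at this
    omega
  · intro u v h h'
    refine C.valid h (Fin.ext ?_)
    have hu := u.2
    have hv := v.2
    simp only [Set.mem_compl_iff, Set.mem_ofPred_eq] at hu hv
    have h' : (C u : ℕ) - a = (C v : ℕ) - a := congrArg Fin.val h'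
    change (C u : ℕ) = (C v : ℕ)
    omega

/-- The largest `n` for which all `n`-colourable graphs are in `P`. -/
noncomputable def rank (P : AddHer) : ℕ := sSup {n | P.HasColorable n}

theorem IsProper.bddAbove {P : AddHer} (hP : P.IsProper) : BddAbove {n | P.HasColorable n} := by
  obtain ⟨m, G, hG⟩ := hP
  refine ⟨m, fun n hn => ?_⟩
  by_contra! h
  exact hG (hn m G (SimpleGraph.Colorable.mono h.le (by simpa using G.colorable_of_fintype)))

theorem IsProper.le_rank {P : AddHer} (hP : P.IsProper) {n : ℕ} (h : P.HasColorable n) :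
    n ≤ P.rank :=
  le_csSup hP.bddAbove h

theorem IsProper.hasColorable_rank {P : AddHer} (hP : P.IsProper) : P.HasColorable P.rank :=
  Nat.sSup_mem ⟨0, P.hasColorable_zero⟩ hP.bddAbove

theorem IsProper.rank_pos {P : AddHer} (hP : P.IsProper) (h : P ≠ 1) : 0 < P.rank :=
  hP.le_rank (hasColorable_one h)

theorem le_mul_left (P Q : AddHer) : P ≤ P * Q := by
  calc P = P * 1 := (mul_one P).symm
    _ ≤ P * Q := mul_le_mul_right (one_le Q) P

theorem le_mul_right (P Q : AddHer) : Q ≤ P * Q := by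
  rw [mul_comm]
  exact le_mul_left Q P

/-- This superadditivity, together with positivity of the rank for nontrivial proper classes, drives
the inductions in cancellation and factorization. Properness bounds the colour numbers, so that the
suprema are attained. -/
theorem rank_add_le {P Q R : AddHer} (hR : R.IsProper) (h : P * Q ≤ R) :
    P.rank + Q.rank ≤ R.rank := by
  have hP := hR.anti ((le_mul_left P Q).trans h)
  have hQ := hR.anti ((le_mul_right P Q).trans h)
  exact hR.le_rank fun m G hG => ((hP.hasColorable_rank.mul hQ.hasColorable_rank) m G hG).mono h

end Rank

/-- Cancellation of proper classes. -/
theorem le_of_mul_le_mul_of_isProper {F A C : AddHer} (hC : C.IsProper) (h : F * C ≤ A * C) :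
    F ≤ A := by
  induction hn : C.rank using Nat.strong_induction_on generalizing F A C with
  | _ n ih =>
    subst hn
    obtain ⟨X, hX, hX'⟩ := exists_refinement (A := fun b : Bool => cond b F C)
      (B := fun b : Bool => cond b A C) (by simpa [Fintype.prod_bool] using h)
    have h1 : F ≤ X true true * X true false := by simpa using hX true
    have h2 : C ≤ X false true * X false false := by simpa using hX false
    have h3 : X true true * X false true ≤ A := by simpa using hX' true
    have h4 : X true false * X false false ≤ C := by simpa using hX' false
    -- Here `X true false` is the piece of `F` that goes into `C`. If it is trivial, `F` goes
    -- entirely into `A`. Otherwise `X false false` has smaller rank than `C`, and cancelling it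
    -- from `X true false * X false false ≤ C ≤ X false true * X false false` allows the piece to be
    -- replaced by one that fits into `A`.
    by_cases ht : X true false = 1
    · rw [ht, mul_one] at h1
      exact h1.trans ((le_mul_left _ _).trans h3)
    · have hp : (X true false).IsProper := hC.anti ((le_mul_left _ _).trans h4)
      have hp' : (X false false).IsProper := hC.anti ((le_mul_right _ _).trans h4)
      have hlt : (X false false).rank < C.rank := by
        have := rank_add_le hC h4
        have := hp.rank_pos ht
        omega
      have h5 : X true false ≤ X false true := ih _ hlt hp' (h4.trans h2) rfl
      exact h1.trans ((mul_le_mul_right h5 _).trans h3)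

/-- If `P * Q` contained all graphs, then so would its product bound: the class of all graphs times
`Q` lies below `P * Q`, and cancelling `Q` leaves the class of all graphs below `P`. -/
theorem IsProper.mul {P Q : AddHer} (hP : P.IsProper) (hQ : Q.IsProper) : (P * Q).IsProper := by
  by_contra hcon
  simp only [IsProper, not_exists, not_not] at hcon
  obtain ⟨n, G, hG⟩ := hP
  let all : AddHer := ⟨⟨Set.univ, fun _ _ _ _ => trivial⟩, trivial,
    fun G _ H _ => by
      obtain ⟨F, e⟩ := exists_finGraph_iso (G.graph ⊕g H.graph)
      exact ⟨F, trivial, e⟩,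
    fun G _ U => by
      obtain ⟨F, e⟩ := exists_finGraph_iso (G.graph.induce U)
      exact ⟨F, trivial, e⟩⟩
  have : all ≤ P := le_of_mul_le_mul_of_isProper hQ (le_of_has fun n G _ => hcon n G)
  exact hG (Has.mono this ⟨⟨n, G⟩, trivial, ⟨SimpleGraph.Iso.refl⟩⟩)

theorem isProper_one : (1 : AddHer).IsProper :=
  ⟨1, ⊥, fun h => (one_has_iff.1 h).elim 0⟩

theorem isProper_prod (P : ι → AddHer) (s : Finset ι) (h : ∀ i ∈ s, (P i).IsProper) :
    (∏ i ∈ s, P i).IsProper :=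
  Finset.prod_induction P IsProper (fun _ _ => IsProper.mul) isProper_one h

/-- `P` is irreducible among the proper classes. -/
structure Irred (P : AddHer) : Prop where
  ne_one : P ≠ 1
  proper : P.IsProper
  eq_one_or : ∀ A B : AddHer, P = A * B → A = 1 ∨ B = 1

/-- In a nontrivial factorization both factors have positive rank, hence each has rank strictly
below that of `P`. -/
theorem exists_factorization {P : AddHer} (hP : P.IsProper) :
    ∃ (k : ℕ) (Q : Fin k → AddHer), (∀ i, (Q i).Irred) ∧ P = ∏ i, Q i := by
  induction hn : P.rank using Nat.strong_induction_on generalizing P with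
  | _ n ih =>
    subst hn
    by_cases h1 : P = 1
    · exact ⟨0, finZeroElim, fun i => i.elim0, by simpa using h1⟩
    by_cases hI : P.Irred
    · exact ⟨1, fun _ => P, fun _ => hI, by simp⟩
    obtain ⟨A, B, hAB, hA, hB⟩ : ∃ A B : AddHer, P = A * B ∧ A ≠ 1 ∧ B ≠ 1 := by
      by_contra! hcon
      exact hI ⟨h1, hP, fun A B h => or_iff_not_imp_left.2 (hcon A B h)⟩
    have hpA := hP.anti ((le_mul_left A B).trans hAB.ge)
    have hpB := hP.anti ((le_mul_right A B).trans hAB.ge)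
    have hr := rank_add_le hP hAB.ge
    have hrA := hpA.rank_pos hA
    have hrB := hpB.rank_pos hB
    obtain ⟨k, Q, hQ, rfl⟩ := ih A.rank (by omega) hpA rfl
    obtain ⟨l, R, hR, rfl⟩ := ih B.rank (by omega) hpB rfl
    refine ⟨k + l, Fin.append Q R, fun i => ?_, ?_⟩
    · refine Fin.addCases (fun i => ?_) (fun i => ?_) i
      · simpa using hQ i
      · simpa using hR i
    · simp [Fin.prod_univ_add, hAB]

/-- A refinement of a product of irreducible classes by itself is a permutation, up to trivial
factors. -/
theorem exists_perm_of_refinement [Fintype ι] [DecidableEq ι] {P : ι → AddHer}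
    (hP : ∀ i, (P i).Irred) {X : ι → ι → AddHer} (h1 : ∀ i, P i ≤ ∏ j, X i j)
    (h2 : ∀ j, ∏ i, X i j ≤ P j) :
    ∃ φ : Equiv.Perm ι, (∀ i j, φ.SameCycle i j → P i = P j) ∧ ∀ i j, j ≠ φ i → X i j = 1 := by
  -- Replacing `P i` by its row product does not lift the total product above `∏ P j`; the other
  -- factors are proper and cancel.
  have hrow : ∀ i, P i = ∏ j, X i j := by
    intro i
    refine (h1 i).antisymm (le_of_mul_le_mul_of_isProper
      (C := ∏ l ∈ Finset.univ.erase i, P l) (isProper_prod _ _ fun l _ => (hP l).proper) ?_)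
    calc (∏ j, X i j) * ∏ l ∈ Finset.univ.erase i, P l
        ≤ (∏ j, X i j) * ∏ l ∈ Finset.univ.erase i, ∏ j, X l j :=
          mul_le_mul_right (Finset.prod_le_prod' fun l _ => h1 l) _
      _ = ∏ l, ∏ j, X l j := Finset.mul_prod_erase _ (fun l => ∏ j, X l j) (Finset.mem_univ i)
      _ = ∏ j, ∏ l, X l j := Finset.prod_comm
      _ ≤ ∏ j, P j := Finset.prod_le_prod' fun j _ => h2 j
      _ = P i * ∏ l ∈ Finset.univ.erase i, P l :=
          (Finset.mul_prod_erase _ _ (Finset.mem_univ i)).symm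
  have hex : ∀ i, ∃ j, X i j ≠ 1 := by
    intro i
    by_contra! hcon
    exact (hP i).ne_one ((hrow i).trans (Finset.prod_eq_one fun j _ => hcon j))
  choose φ hφ using hex
  -- Irreducibility leaves one nontrivial entry in each row; the product of the others is `1`, the
  -- least class, so each of them is `1`.
  have hone : ∀ i j, j ≠ φ i → X i j = 1 := by
    intro i j hj
    have h3 := hrow i
    rw [← Finset.mul_prod_erase _ _ (Finset.mem_univ (φ i))] at h3
    have h4 := ((hP i).eq_one_or _ _ h3).resolve_left (hφ i)
    refine ((one_le _).antisymm' ?_)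
    rw [← h4, ← Finset.mul_prod_erase _ _ (Finset.mem_erase.2 ⟨hj, Finset.mem_univ j⟩)]
    exact le_mul_left _ _
  have heq : ∀ i, P i = X i (φ i) := by
    intro i
    rw [hrow i]
    exact Fintype.prod_eq_single _ fun j hj => hone i j hj
  have hle : ∀ i, P i ≤ P (φ i) := fun i =>
    (heq i).le.trans ((le_prod (fun l => X l (φ i)) i).trans (h2 _))
  -- Rank counting makes `φ` surjective: the ranks over a fibre sum to at most the rank of the
  -- target, the totals agree, so equality holds in each fibre, and positive rank excludes empty
  -- fibres.
  have hfib : ∀ j, ∑ i with φ i = j, (P i).rank ≤ (P j).rank := by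
    intro j
    have key : ∀ s : Finset ι, (∑ i ∈ s with φ i = j, (P i).rank) ≤ (∏ i ∈ s, X i j).rank := by
      intro s
      induction s using Finset.induction_on with
      | empty => simp
      | insert a s ha ih =>
        have hprop : ∀ s : Finset ι, (∏ i ∈ s, X i j).IsProper := fun s =>
          isProper_prod _ _ fun i _ =>
            (hP j).proper.anti ((le_prod (fun l => X l j) i).trans (h2 j))
        have hadd := rank_add_le (hprop (insert a s)) (Finset.prod_insert ha).ge
        rw [Finset.filter_insert]
        split_ifs with haj
        · rw [Finset.sum_insert (by simp [ha]), heq a, haj]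
          omega
        · omega
    refine (key Finset.univ).trans ?_
    -- The unit as second factor turns superadditivity into monotonicity of the rank.
    have := rank_add_le (P := ∏ i, X i j) (Q := 1) (hP j).proper (by simpa using h2 j)
    omega
  have hsum : ∑ j, ∑ i with φ i = j, (P i).rank = ∑ j, (P j).rank :=
    Finset.sum_fiberwise _ _ _
  have hfib' := (Finset.sum_eq_sum_iff_of_le fun j _ => hfib j).1 hsum
  have hsurj : Function.Surjective φ := by
    intro j
    have hpos := (hP j).proper.rank_pos (hP j).ne_one
    rw [← hfib' j (Finset.mem_univ j)] at hpos
    obtain ⟨i, hi, -⟩ := Finset.exists_ne_zero_of_sum_ne_zero hpos.ne'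
    exact ⟨i, (Finset.mem_filter.1 hi).2⟩
  let ψ : Equiv.Perm ι := Equiv.ofBijective φ (Finite.surjective_iff_bijective.1 hsurj)
  have hpow : ∀ (n : ℕ) i, P i ≤ P ((ψ ^ n) i) := by
    intro n
    induction n with
    | zero => intro i; rfl
    | succ n ih =>
      intro i
      rw [pow_succ', Equiv.Perm.mul_apply]
      exact (ih i).trans (hle _)
  -- The classes increase along `ψ`, so going round a cycle forces equality.
  have hcyc : ∀ i j, ψ.SameCycle i j → P i ≤ P j := by
    intro i j hij
    obtain ⟨n, -, rfl⟩ := hij.exists_pow_eq'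
    exact hpow n i
  exact ⟨ψ, fun i j hij => (hcyc i j hij).antisymm (hcyc j i hij.symm), hone⟩

/-- A colouring that splits all blow-ups of the members of irreducible classes is a permutation of
the sorts. -/
theorem SplitsMembers.exists_perm [Fintype ι] [DecidableEq ι] {P : ι → AddHer}
    (hP : ∀ i, (P i).Irred) {χ : Member P → ι} (hχ : SplitsMembers (B := P) χ) :
    ∃ φ : Equiv.Perm ι, (∀ i j, φ.SameCycle i j → P i = P j) ∧ ∀ x, χ x = φ x.sort := by
  obtain ⟨φ, hφ, hone⟩ := exists_perm_of_refinement hP (le_prod_colorClass χ)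
    (prod_colorClass_le hχ)
  refine ⟨φ, hφ, fun x => ?_⟩
  by_contra hne
  exact eq_empty_of_copies_eq_one (hone x.sort (χ x) hne) x ⟨rfl, rfl⟩

end AddHer

/-! ### Uniquely partitionable graphs -/

namespace AddHer

open GraphProperty

variable {V W ι : Type}

/-- A minimal graph outside of `P`, split into a vertex and a graph `T` in `P`; the set `N` is the
neighbourhood of that vertex. -/
theorem IsProper.exists_critical {P : AddHer} (hP : P.IsProper) :
    ∃ (n : ℕ) (T : SimpleGraph (Fin n)) (N : Set (Fin n)), P.Has T ∧
      ∀ {W : Type} (G : SimpleGraph W) (U : Set W) (w : W) (g : Fin n → W), w ∈ U → (∀ a, g a ∈ U) →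
        (∀ a, g a ≠ w) → g.Injective → (∀ a b, T.Adj a b ↔ G.Adj (g a) (g b)) →
        (∀ a, a ∈ N ↔ G.Adj w (g a)) → ¬ P.Has (G.induce U) := by
  classical
  obtain ⟨n, ⟨F, hF⟩, hmin⟩ : ∃ n, (∃ F : SimpleGraph (Fin n), ¬ P.Has F) ∧
      ∀ m < n, ¬ ∃ F : SimpleGraph (Fin m), ¬ P.Has F :=
    ⟨_, Nat.find_spec (p := fun n => ∃ F : SimpleGraph (Fin n), ¬ P.Has F) hP,
      fun m hm => Nat.find_min (p := fun n => ∃ F : SimpleGraph (Fin n), ¬ P.Has F) hP hm⟩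
  rcases n with _ | n
  · exact absurd (P.has_of_isEmpty _) hF
  have hT : P.Has (F.comap Fin.succ) := by
    by_contra h
    exact hmin n (Nat.lt_succ_self n) ⟨_, h⟩
  -- Vertex `0` of a forbidden graph of least order is removed; by minimality the rest lies in `P`.
  refine ⟨n, F.comap Fin.succ, {a | F.Adj 0 a.succ}, hT, ?_⟩
  intro W G U w g hw hg hne hinj hT hN h
  refine hF (h.of_induce_of_map (Fin.cases w g) ?_ ?_ ?_)
  · exact Fin.cases hw hg
  · intro a b
    refine Fin.cases ?_ (fun a => ?_) a <;> refine Fin.cases ?_ (fun b => ?_) b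
    · simp
    · exact fun h => absurd h.symm (hne b)
    · exact fun h => absurd h (hne a)
    · exact fun h => congrArg Fin.succ (hinj h)
  · intro a b
    refine Fin.cases ?_ (fun a => ?_) a <;> refine Fin.cases ?_ (fun b => ?_) b
    · simp
    · simpa using hN b
    · rw [SimpleGraph.adj_comm F, SimpleGraph.adj_comm G]
      simpa using hN a
    · simpa using hT a b

/-- A vertex `w` together with a copy in `G` of the sort `i` part of `S`, where `w` is adjacent to
exactly the copies of the elements of `N`, is contained in no induced subgraph in `P i`. -/
def IsCritical (P : ι → AddHer) (S : Finset (Member P)) (N : Set (Member P)) : Prop :=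
  ∀ (i : ι) {W : Type} (G : SimpleGraph W) (U : Set W) (w : W)
    (g : {x : Member P // x ∈ S ∧ x.sort = i} → W), w ∈ U → (∀ x, g x ∈ U) →
    (∀ x, g x ≠ w) → g.Injective → (∀ x y, (memberGraph P).Adj x.1 y.1 ↔ G.Adj (g x) (g y)) →
    (∀ x, x.1 ∈ N ↔ G.Adj w (g x)) → ¬ (P i).Has (G.induce U)

/-- The critical graphs of the single classes are themselves members, so they can be collected in
one finite set; the sort keeps the neighbourhoods apart. -/
theorem exists_isCritical [Finite ι] {P : ι → AddHer} (hP : ∀ i, (P i).IsProper) :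
    ∃ S N, IsCritical P S N := by
  classical
  have := Fintype.ofFinite ι
  choose n T N hT hcrit using fun i => (hP i).exists_critical
  refine ⟨Finset.univ.biUnion fun i => Finset.univ.image (Member.ofVertex i (T i) (hT i)),
    {x | ∃ i, ∃ a ∈ N i, Member.ofVertex i (T i) (hT i) a = x}, ?_⟩
  intro i W G U w g hw hg hne hinj hT' hN'
  let v : Fin (n i) → {x // x ∈ Finset.univ.biUnion (fun i => Finset.univ.image
      (Member.ofVertex i (T i) (hT i))) ∧ x.sort = i} := fun a =>
    ⟨Member.ofVertex i (T i) (hT i) a, by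
      simp only [Finset.mem_biUnion, Finset.mem_univ, true_and, Finset.mem_image]
      exact ⟨i, a, rfl⟩, rfl⟩
  refine hcrit i G U w (g ∘ v) hw (fun a => hg _) (fun a => hne _) ?_ ?_ ?_
  · intro a b h
    exact Member.ofVertex_injective (hG := hT i) (congrArg Subtype.val (hinj h))
  · intro a b
    exact (Member.ofVertex_adj (hG := hT i)).symm.trans (hT' (v a) (v b))
  · intro a
    refine Iff.trans ?_ (hN' (v a))
    constructor
    · intro ha
      exact ⟨i, a, ha, rfl⟩
    · rintro ⟨j, b, hb, h⟩
      have hij : j = i := congrArg Member.sort h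
      subst hij
      rwa [← Member.ofVertex_injective (hG := hT j) h]

/-- With no vertex of sort `i`, the critical configuration would be a single vertex, which lies in
every nontrivial class. This makes all parts of the final graph non-empty. -/
theorem IsCritical.exists_mem [Finite ι] {P : ι → AddHer} {S : Finset (Member P)}
    {N : Set (Member P)} (h : IsCritical P S N) {i : ι} (hi : P i ≠ 1) :
    ∃ x ∈ S, x.sort = i := by
  by_contra! hcon
  refine h i (⊥ : SimpleGraph Unit) Set.univ () (fun x => ()) trivial (fun _ => trivial)
    (fun x => absurd x.2.2 (hcon x.1 x.2.1)) (fun x => absurd x.2.2 (hcon x.1 x.2.1))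
    (fun x => absurd x.2.2 (hcon x.1 x.2.1)) (fun x => absurd x.2.2 (hcon x.1 x.2.1)) ?_
  exact (hasColorable_one hi).has ⟨SimpleGraph.Coloring.mk (fun _ => 0) fun h => by simp at h⟩

/-- Large enough finite sets of vertices of members of irreducible classes allow only the
permutations of the sorts as colourings that split all blow-ups. -/
theorem exists_finset_forcing [Fintype ι] [DecidableEq ι] {P : ι → AddHer}
    (hP : ∀ i, (P i).Irred) (S₀ : Finset (Member P)) :
    ∃ S, S₀ ⊆ S ∧ ∀ e, SplitsBlowups ((memberGraph P).induce (S : Set (Member P)))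
      (fun x => x.1.sort) P e →
      ∃ φ : Equiv.Perm ι, (∀ i j, φ.SameCycle i j → P i = P j) ∧
        ∀ x, x.1 ∈ S₀ → e x = φ x.1.sort := by
  classical
  -- If every finite set had a bad colouring, a limit of these would split all members and hence be
  -- an admissible permutation of the sorts. But on `S₀` the limit agrees with one of the bad
  -- colourings.
  by_contra! hcon
  have : ∀ S : Finset (Member P), ∃ g : Member P → ι,
      SplitsBlowups ((memberGraph P).induce (S : Set (Member P))) (fun x => x.1.sort) P
        (fun x => g x.1) ∧
      ∀ φ : Equiv.Perm ι, (∀ i j, φ.SameCycle i j → P i = P j) →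
        ∃ x ∈ S₀, g x ≠ φ x.sort := by
    intro S
    obtain ⟨e, he, hne⟩ := hcon (S ∪ S₀) Finset.subset_union_right
    refine ⟨fun x => if h : x ∈ S ∪ S₀ then e ⟨x, h⟩ else x.sort, ?_, fun φ hφ => ?_⟩
    · have := he.comp (U := (memberGraph P).induce (S : Set (Member P)))
        (fun x => ⟨x.1, Finset.mem_union_left _ x.2⟩)
        (fun x y hxy => Subtype.ext (congrArg (fun z => z.1) hxy)) fun _ _ => Iff.rfl
      have heq : (fun x : (S : Set (Member P)) =>
          if h : x.1 ∈ S ∪ S₀ then e ⟨x.1, h⟩ else x.1.sort) =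
          fun x => e ⟨x.1, Finset.mem_union_left _ x.2⟩ :=
        funext fun x => dif_pos (Finset.mem_union_left _ x.2)
      rw [heq]
      exact this
    · obtain ⟨x, hx, hx'⟩ := hne φ hφ
      exact ⟨x.1, hx, fun h => hx' ((dif_pos (Finset.mem_union_right S hx)).symm.trans h)⟩
  choose g hg hne using this
  obtain ⟨χ, hχ, hlim⟩ := exists_limit g hg
  obtain ⟨φ, hφ, hχφ⟩ := hχ.exists_perm hP
  obtain ⟨S', -, hS'⟩ := hlim S₀
  obtain ⟨x, hx, hx'⟩ := hne S' φ hφ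
  exact hx' ((hS' x hx).symm.trans (hχφ x))

/-- The order in which the copies are attached in `forcingGraph`: the copy `inr true` to the copies
`inl a`, the copy `inr false` to `inr true`, and the copies `inl a` to `inr false`. -/
def AttachedTo {n : ℕ} : Fin n ⊕ Bool → Fin n ⊕ Bool → Prop
  | .inr true, .inl _ => True
  | .inr false, .inr true => True
  | .inl _, .inr false => True
  | _, _ => False

theorem AttachedTo.not_symm {n : ℕ} {a b : Fin n ⊕ Bool} (h : AttachedTo a b) :
    ¬ AttachedTo b a := by
  rcases a with a | _ | _ <;> rcases b with b | _ | _ <;> simp_all [AttachedTo]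

theorem AttachedTo.not_inl {n : ℕ} {a b : Fin n ⊕ Bool} (h : AttachedTo a b) {a' b' : Fin n}
    (ha : a = .inl a') (hb : b = .inl b') : False := by
  subst ha hb
  exact h

/-- The blow-up made of the blow-up `M` and two further copies of `T`, where a vertex of an
attached copy is adjacent to the vertices in `N` of different sort. -/
def forcingGraph {n : ℕ} (T : SimpleGraph V) (c : V → ι) (N : Set V)
    (M : SimpleGraph (Fin n × V)) : SimpleGraph ((Fin n ⊕ Bool) × V) :=
  IsBlowup.mk T c fun x y =>
    (∃ a b, x.1 = .inl a ∧ y.1 = .inl b ∧ M.Adj (a, x.2) (b, y.2)) ∨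
      (AttachedTo x.1 y.1 ∧ y.2 ∈ N)

section forcingGraph

variable {n : ℕ} {T : SimpleGraph V} {c : V → ι} {N : Set V} {M : SimpleGraph (Fin n × V)}

theorem forcingGraph_adj_inl (hM : IsBlowup T c M) (a b : Fin n) (t t' : V) :
    (forcingGraph T c N M).Adj (.inl a, t) (.inl b, t') ↔ M.Adj (a, t) (b, t') := by
  by_cases hc : c t = c t'
  · rw [hM (a, t) (b, t') hc, forcingGraph,
      IsBlowup.isBlowup_mk _ (Sum.inl a, t) (Sum.inl b, t') hc]
    simp
  · have hc' : c ((Sum.inl a : Fin n ⊕ Bool), t).2 ≠ c ((Sum.inl b : Fin n ⊕ Bool), t').2 := hc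
    rw [forcingGraph, IsBlowup.mk_adj_of_ne hc']
    simp [AttachedTo, SimpleGraph.adj_comm M (b, t')]

theorem forcingGraph_adj_of_attachedTo {x y : (Fin n ⊕ Bool) × V} (h : AttachedTo x.1 y.1)
    (hc : c x.2 ≠ c y.2) : (forcingGraph T c N M).Adj x y ↔ y.2 ∈ N := by
  rw [forcingGraph, IsBlowup.mk_adj_of_ne hc]
  constructor
  · rintro ((⟨a, b, ha, hb, -⟩ | ⟨-, h'⟩) | (⟨a, b, ha, hb, -⟩ | ⟨h', -⟩))
    · exact (h.not_inl ha hb).elim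
    · exact h'
    · exact (h.not_inl hb ha).elim
    · exact (h.not_symm h').elim
  · exact fun h' => Or.inl (Or.inr ⟨h, h'⟩)

end forcingGraph

/-- If the parts of `S₀` in certain copies are coloured by a permutation of the sorts, then so is
every copy attached to these copies. -/
theorem color_eq_of_attachedTo [Fintype ι] {P : ι → AddHer} {S₀ S : Finset (Member P)}
    {N : Set (Member P)} (hcrit : IsCritical P S₀ N) (hS : S₀ ⊆ S) {n : ℕ}
    {M : SimpleGraph (Fin n × (S : Set (Member P)))}
    {d : (Fin n ⊕ Bool) × (S : Set (Member P)) → ι}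
    (hd : ∀ i, (P i).Has ((forcingGraph ((memberGraph P).induce (S : Set (Member P)))
      (fun x => x.1.sort) {x | x.1 ∈ N} M).induce {x | d x = i}))
    {φ : Equiv.Perm ι} (hφ : ∀ i j, φ.SameCycle i j → P i = P j) (κ : ι → Fin n ⊕ Bool)
    (hκ : ∀ x, x.1 ∈ S₀ → d (κ x.1.sort, x) = φ x.1.sort) {a : Fin n ⊕ Bool}
    (ha : ∀ i, AttachedTo a (κ i)) (x : (S : Set (Member P))) : d (a, x) = φ x.1.sort := by
  by_contra hne
  obtain ⟨i, hi⟩ := φ.surjective (d (a, x))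
  have hne' : x.1.sort ≠ i := by
    rintro rfl
    exact hne hi.symm
  have hPi : P i = P (d (a, x)) := hφ _ _ ⟨1, by simpa using hi⟩
  -- If the vertex took the colour `φ i` of a foreign sort `i`, it would complete the sort `i` part
  -- of `S₀` in copy `κ i` to a forbidden graph inside one colour class. The copy may depend on the
  -- sort because each use concerns a single sort.
  refine hcrit i (forcingGraph ((memberGraph P).induce (S : Set (Member P)))
      (fun x => x.1.sort) {x | x.1 ∈ N} M) {y | d y = d (a, x)} (a, x)
    (fun y => (κ i, ⟨y.1, hS y.2.1⟩)) rfl ?_ ?_ ?_ ?_ ?_ (hPi ▸ hd _)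
  · rintro ⟨y, hy, rfl⟩
    exact (hκ ⟨y, hS hy⟩ hy).trans hi
  · rintro ⟨y, hy, rfl⟩ h
    exact hne' (congrArg (fun z => z.2.1.sort) h).symm
  · intro y z h
    exact Subtype.ext (congrArg (fun z => z.2.1) h)
  · intro y z
    rw [forcingGraph, IsBlowup.isBlowup_mk]
    · simp
    · exact y.2.2.trans z.2.2.symm
  · intro y
    rw [forcingGraph_adj_of_attachedTo (ha i)]
    · rfl
    · intro h
      exact hne' (h.trans y.2.2)

/-- Uniquely partitionable graphs exist for every finite family of irreducible classes. -/
theorem exists_uniquely_partitionable [Fintype ι] [DecidableEq ι] {P : ι → AddHer}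
    (hP : ∀ i, (P i).Irred) :
    ∃ (n : ℕ) (H : SimpleGraph (Fin n)) (c : Fin n → ι), c.Surjective ∧
      (∀ i, (P i).Has (H.induce {v | c v = i})) ∧
      ∀ d : Fin n → ι, (∀ i, (P i).Has (H.induce {v | d v = i})) →
        ∃ φ : Equiv.Perm ι, (∀ i j, φ.SameCycle i j → P i = P j) ∧ ∀ v, d v = φ (c v) := by
  classical
  obtain ⟨S₀, N, hcrit⟩ := exists_isCritical fun i => (hP i).proper
  obtain ⟨S, hS, hforce⟩ := exists_finset_forcing hP S₀
  let T := (memberGraph P).induce (S : Set (Member P))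
  let c : ↥(S : Set (Member P)) → ι := fun x => x.1.sort
  obtain ⟨k, G, hG, hk, hsplit⟩ := SplitsBlowups.exists_universal_blowup T c P
  obtain ⟨m, M, hM, hram⟩ := hG.exists_ramsey (J := ι)
  let H := forcingGraph T c {x | x.1 ∈ N} M
  have hsort : ∀ i, (P i).Has (H.induce {x | c x.2 = i}) := fun i =>
    IsBlowup.has_sort (IsBlowup.isBlowup_mk _) ((memberGraph_has_sort S i).induce_of_map
      Subtype.val (fun x hx => ⟨x.2, hx⟩) Subtype.val_injective.injOn fun _ _ _ _ => Iff.rfl)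
  have huniq : ∀ d : (Fin m ⊕ Bool) × (S : Set (Member P)) → ι,
      (∀ i, (P i).Has (H.induce {v | d v = i})) →
        ∃ φ : Equiv.Perm ι, (∀ i j, φ.SameCycle i j → P i = P j) ∧ ∀ v, d v = φ (c v.2) := by
    intro d hd
    -- The Ramsey copy of the universal blow-up gives a colouring of `T` that splits all blow-ups,
    -- hence a permutation on `S₀`.
    obtain ⟨e, h, hinj, he, hadj⟩ := hram fun x => d (.inl x.1, x.2)
    have hes : SplitsBlowups T c P e := by
      refine hsplit e fun j => ?_
      refine (hd j).induce_of_map (fun x => (.inl (h (x.1, c x.2)), x.2))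
        (fun x hx => (he _ _).trans hx) ?_ ?_
      · intro x _ y _ hxy
        simp only [Prod.mk.injEq, Sum.inl.injEq, hinj.eq_iff] at hxy
        exact Prod.ext hxy.1.1 hxy.2
      · intro x _ y _
        rw [forcingGraph_adj_inl hM]
        exact hadj _ _ _ _
    obtain ⟨φ, hφ, heφ⟩ := hforce e hes
    refine ⟨φ, hφ, ?_⟩
    -- The Ramsey embedding scatters the sorts of copy `0` over different copies in `M`. The copy
    -- `inr true`, attached to them all, is fixed first; it fixes `inr false`, which in turn fixes
    -- every copy in `M`, including those outside the Ramsey embedding.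
    have h1 : ∀ x, d (.inr true, x) = φ (c x) :=
      color_eq_of_attachedTo hcrit hS hd hφ (fun i => .inl (h (⟨0, hk⟩, i)))
        (fun x hx => (he ⟨0, hk⟩ x).trans (heφ x hx)) fun _ => trivial
    have h2 : ∀ x, d (.inr false, x) = φ (c x) :=
      color_eq_of_attachedTo hcrit hS hd hφ (fun _ => .inr true) (fun x _ => h1 x) fun _ => trivial
    rintro ⟨a | _ | _, x⟩
    · exact color_eq_of_attachedTo (a := .inl a) hcrit hS hd hφ (fun _ => .inr false) (fun x _ => h2 x)
        (fun _ => trivial) x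
    · exact h2 x
    · exact h1 x
  obtain ⟨n, ⟨f⟩⟩ := Finite.exists_equiv_fin ((Fin m ⊕ Bool) × (S : Set (Member P)))
  refine ⟨n, H.comap f.symm, fun v => c (f.symm v).2, ?_, fun i => ?_, fun d hd => ?_⟩
  · intro i
    obtain ⟨x, hx, rfl⟩ := hcrit.exists_mem (hP i).ne_one
    exact ⟨f (.inr true, ⟨x, hS hx⟩), by simp [c]⟩
  · exact (hsort i).induce_of_map f.symm (fun v hv => hv) f.symm.injective.injOn
      fun _ _ _ _ => Iff.rfl
  · obtain ⟨φ, hφ, h⟩ := huniq (d ∘ f) fun i => (hd i).induce_of_map f (fun v hv => hv)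
      f.injective.injOn fun _ _ _ _ => by simp
    exact ⟨φ, hφ, fun v => by simpa using h (f.symm v)⟩

end AddHer

/-! ### The reduction -/

namespace AddHer

open GraphProperty

/-- An additive induced-hereditary property as a class. -/
def ofProperty {P : GraphProperty} (hP : P.IsAdditiveInducedHereditary) : AddHer :=
  ⟨P, hP.nontrivial.1, hP.additive, hP.inducedHereditary⟩

theorem ofProperty_ne_one {P : GraphProperty} (hP : P.IsAdditiveInducedHereditary) :
    ofProperty hP ≠ 1 := by
  obtain ⟨G, hG, hn⟩ := hP.nontrivial.2.1
  intro h
  have : (ofProperty hP).Has G.graph := mem_iff_has.1 hG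
  rw [h, one_has_iff] at this
  exact this.elim ⟨0, hn⟩

theorem ofProperty_isProper {P : GraphProperty} (hP : P.IsAdditiveInducedHereditary) :
    (ofProperty hP).IsProper := by
  obtain ⟨G, -, hG⟩ := hP.nontrivial.2.2
  exact ⟨G.n, G.graph, fun h => hG (mem_iff_has.2 h)⟩

theorem isAdditiveInducedHereditary {P : AddHer} (h1 : P ≠ 1) (hP : P.IsProper) :
    P.prop.IsAdditiveInducedHereditary where
  nontrivial := by
    refine ⟨P.null_mem, ⟨⟨1, ⊥⟩, mem_iff_has.2 ?_, Nat.one_pos⟩, ?_⟩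
    · exact hasColorable_one h1 _ _ ⟨SimpleGraph.Coloring.mk (fun _ => 0) fun h => by simp at h⟩
    · obtain ⟨n, G, hG⟩ := hP
      refine ⟨⟨n, G⟩, ?_, fun h => hG (mem_iff_has.1 h)⟩
      rcases n with _ | n
      · exact absurd (P.has_of_isEmpty G) hG
      · exact Nat.succ_pos n
  additive := P.additive
  inducedHereditary := P.hereditary

/-- Nontrivial properties are different from the unit, so `eq_one_or` excludes every factorization
into two of them. -/
theorem Irred.isIrreducible {P : AddHer} (hP : P.Irred) : P.prop.IsIrreducible := by
  refine ⟨isAdditiveInducedHereditary hP.ne_one hP.proper, ?_⟩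
  rintro ⟨A, B, hA, hB, h⟩
  have : P = ofProperty hA * ofProperty hB := AddHer.ext h
  rcases hP.eq_one_or _ _ this with h | h
  · exact ofProperty_ne_one hA h
  · exact ofProperty_ne_one hB h

section Reduction

variable {α β V W : Type} [Fintype α] [Fintype β] [Finite V] [Finite W]
  {P : α → AddHer} {Q : β → AddHer} {G : SimpleGraph V} {H : SimpleGraph W} {c : W → α ⊕ β}

/-- All new edges end in `Q`-parts, so adding the parts of `G` to the `P`-parts of `H` only forms
disjoint unions. -/
theorem prod_has_attachAux (hc : ∀ i, (Sum.elim P Q i).Has (H.induce {u | c u = i}))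
    {S : Set W} (hS : ∀ u ∈ S, (c u).isRight = true) (hG : (∏ a, P a).Has G) :
    ((∏ a, P a) * ∏ b, Q b).Has (FinGraph.attachAux G H S) := by
  obtain ⟨g, hg⟩ := (prod_has_iff P).1 hG
  have hprod : (∏ a, P a) * ∏ b, Q b = ∏ i, Sum.elim P Q i := by simp [Fintype.prod_sum_type]
  rw [hprod, prod_has_iff]
  refine ⟨Sum.elim (fun x => Sum.inl (g x)) c, ?_⟩
  rintro (a | b)
  · have hS' : ∀ u, c u = .inl a → u ∉ S := fun u hu h => by
      have := hS u h
      rw [hu] at this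
      simp at this
    refine Has.of_map (P := P a) ((P a).additive.has_sum (hg a) (hc (.inl a)))
      (fun x => match x with
        | ⟨.inl x, hx⟩ => Sum.inl ⟨x, Sum.inl_injective hx⟩
        | ⟨.inr u, hu⟩ => Sum.inr ⟨u, hu⟩) ?_ ?_
    · rintro ⟨x | u, hx⟩ ⟨y | v, hy⟩ h
      · simpa [Subtype.ext_iff] using h
      · simp at h
      · simp at h
      · simpa [Subtype.ext_iff] using h
    · rintro ⟨x | u, hx⟩ ⟨y | v, hy⟩
      · simp [FinGraph.attachAux]
      · simpa [FinGraph.attachAux] using hS' v hy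
      · simpa [FinGraph.attachAux] using hS' u hx
      · simp [FinGraph.attachAux]
  · refine Has.of_map (P := Q b) (hc (.inr b))
      (fun x => match x with
        | ⟨.inl x, hx⟩ => absurd hx (by simp)
        | ⟨.inr u, hu⟩ => ⟨u, hu⟩) ?_ ?_
    · rintro ⟨x | u, hx⟩ ⟨y | v, hy⟩ h
      · simp at hx
      · simp at hx
      · simp at hy
      · simpa [Subtype.ext_iff] using h
    · rintro ⟨x | u, hx⟩ ⟨y | v, hy⟩
      · simp at hx
      · simp at hx
      · simp at hy
      · simp [FinGraph.attachAux]

theorem prod_has_of_attachAux (hc : ∀ i, (Sum.elim P Q i).Has (H.induce {u | c u = i}))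
    (hsurj : c.Surjective)
    (huniq : ∀ d : W → α ⊕ β, (∀ i, (Sum.elim P Q i).Has (H.induce {u | d u = i})) →
      ∃ φ : Equiv.Perm (α ⊕ β), (∀ i j, φ.SameCycle i j → Sum.elim P Q i = Sum.elim P Q j) ∧
        ∀ u, d u = φ (c u))
    {v : W} {a : α} (hv : c v = .inl a)
    (hG : ((∏ a, P a) * ∏ b, Q b).Has
      (FinGraph.attachAux G H {u | H.Adj v u ∧ (c u).isRight = true})) : (∏ a, P a).Has G := by
  classical
  have hprod : (∏ a, P a) * ∏ b, Q b = ∏ i, Sum.elim P Q i := by simp [Fintype.prod_sum_type]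
  rw [hprod, prod_has_iff] at hG
  obtain ⟨d, hd⟩ := hG
  obtain ⟨φ, hφ, hdφ⟩ := huniq (fun u => d (.inr u)) fun i =>
    (hd i).induce_of_map Sum.inr (fun u hu => hu) Sum.inr_injective.injOn fun _ _ _ _ => Iff.rfl
  have hφ' : ∀ i, Sum.elim P Q i = Sum.elim P Q (φ i) := fun i => hφ _ _ ⟨1, by simp⟩
  -- If `x` had the colour of a `Q`-part, then `v` could be moved into that part of `H`, since `x`
  -- has the same neighbours there as `v`. The new partition gives `v` and a vertex `w` of that part
  -- the same colour, which no permutation of the old parts does.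
  have hright : ∀ x b, d (.inl x) ≠ φ (.inr b) := by
    intro x b hxb
    obtain ⟨φ', -, h'⟩ := huniq (fun u => if u = v then .inr b else c u) fun i => by
      by_cases hi : i = .inr b
      · subst hi
        have hcu : ∀ u, (if u = v then Sum.inr b else c u) = .inr b → u ≠ v → c u = .inr b := by
          intro u hu huv
          rwa [if_neg huv] at hu
        have := hd (φ (.inr b))
        rw [← hφ'] at this
        refine this.induce_of_map (fun u => if u = v then .inl x else .inr u) ?_ ?_ ?_
        · intro u hu
          by_cases huv : u = v
          · simpa [huv] using hxb
          · simp [huv, hdφ, hcu u hu huv]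
        · intro u hu w hw h
          by_cases huv : u = v <;> by_cases hwv : w = v <;> simp [huv, hwv] at h ⊢
          exact h
        · intro u hu w hw
          by_cases huv : u = v <;> by_cases hwv : w = v
          · simp [huv, hwv]
          · simp [huv, hwv, FinGraph.attachAux, hcu w hw hwv]
          · simp [huv, hwv, FinGraph.attachAux, hcu u hu huv, SimpleGraph.adj_comm H u]
          · simp [huv, hwv, FinGraph.attachAux]
      · refine (hc i).induce_mono fun u hu => ?_
        by_cases huv : u = v
        · simp only [Set.mem_ofPred_eq, huv, if_true] at hu
          exact absurd hu.symm hi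
        · simpa [huv] using hu
    obtain ⟨w, hw⟩ := hsurj (.inr b)
    have hwv : w ≠ v := by
      rintro rfl
      rw [hv] at hw
      cases hw
    have h1 := h' v
    have h2 := h' w
    rw [if_pos rfl, hv] at h1
    rw [if_neg hwv, hw] at h2
    cases φ'.injective (h1.symm.trans h2)
  have hleft : ∀ x, ∃ a, d (.inl x) = φ (.inl a) := by
    intro x
    rcases h : φ.symm (d (.inl x)) with a | b
    · exact ⟨a, by rw [← h, Equiv.apply_symm_apply]⟩
    · exact absurd (by rw [← h, Equiv.apply_symm_apply]) (hright x b)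
  choose g hg using hleft
  refine (prod_has_iff P).2 ⟨g, fun a => ?_⟩
  have := hd (φ (.inl a))
  rw [← hφ'] at this
  refine this.induce_of_map (P := P a) Sum.inl ?_ Sum.inl_injective.injOn fun _ _ _ _ => Iff.rfl
  rintro x rfl
  exact hg x

end Reduction

end AddHer

open AddHer GraphProperty in
theorem exists_reduction_graph (A B : GraphProperty)
    (hA : A.IsAdditiveInducedHereditary) (hB : B.IsAdditiveInducedHereditary) :
    ∃ (k l : ℕ) (P : Fin k → GraphProperty) (Q : Fin l → GraphProperty)
      (H : FinGraph) (c : Fin H.n → Fin k ⊕ Fin l) (v : Fin H.n),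
      (∀ i, (P i).IsIrreducible) ∧ (∀ j, (Q j).IsIrreducible) ∧
      A = GraphProperty.prodFamily P ∧ B = GraphProperty.prodFamily Q ∧
      GraphProperty.IsStronglyUniquePartition (Sum.elim P Q) H.graph c ∧
      Function.Surjective c ∧ (c v).isLeft = true ∧
      ∀ G : FinGraph, G ∈ A.carrier ↔
        FinGraph.attach H {u | H.graph.Adj v u ∧ (c u).isRight = true} G ∈ (A.prod B).carrier := by
  obtain ⟨k, P, hP, hPA⟩ := exists_factorization (ofProperty_isProper hA)
  obtain ⟨l, Q, hQ, hQB⟩ := exists_factorization (ofProperty_isProper hB)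
  have hA' : A = (∏ i, P i).prop := congrArg AddHer.prop hPA
  have hB' : B = (∏ j, Q j).prop := congrArg AddHer.prop hQB
  obtain ⟨n, H, c, hsurj, hc, huniq⟩ := exists_uniquely_partitionable
    (P := Sum.elim P Q) (by rintro (i | j); exacts [hP i, hQ j])
  -- An empty product is `1`, which `A` is not; this is what supplies a `P`-part containing `v`.
  have hk : k ≠ 0 := by
    rintro rfl
    exact ofProperty_ne_one hA (by simpa using hPA)
  obtain ⟨v, hv⟩ := hsurj (.inl ⟨0, Nat.pos_of_ne_zero hk⟩)
  have helim : Sum.elim (fun i => (P i).prop) (fun j => (Q j).prop) =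
      fun i => (Sum.elim P Q i).prop := by
    funext i
    cases i <;> rfl
  refine ⟨k, l, fun i => (P i).prop, fun j => (Q j).prop, ⟨n, H⟩, c, v,
    fun i => (hP i).isIrreducible, fun j => (hQ j).isIrreducible,
    hA'.trans (prod_prop P), hB'.trans (prod_prop Q), ⟨?_, fun d hd => ?_⟩, hsurj,
    by rw [hv]; rfl, fun G => ?_⟩
  · rw [helim]
    exact hc
  · rw [helim] at hd
    obtain ⟨φ, hφ, h⟩ := huniq d hd
    refine ⟨φ, fun i => ?_, fun i j hij => ?_⟩
    · ext u
      simp [h u]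
    · rw [helim]
      exact congrArg AddHer.prop (hφ i j hij)
  · rw [mem_iff_has, mem_iff_has, hA', hB', ← mul_prop]
    have e : FinGraph.attachAux G.graph H {u | H.Adj v u ∧ (c u).isRight = true} ≃g
        (FinGraph.attach ⟨n, H⟩ {u | H.Adj v u ∧ (c u).isRight = true} G).graph :=
      (SimpleGraph.Iso.comap finSumFinEquiv.symm _).symm
    rw [← has_congr e]
    exact ⟨prod_has_attachAux hc fun u hu => hu.2, prod_has_of_attachAux hc hsurj huniq hv⟩

/-! ### A Turing machine that attaches a fixed graph -/

namespace FinGraph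

open Turing Turing.TM2.Stmt

section Machine

variable (H : FinGraph) (S : Set (Fin H.n))

/-- The labels of the machine that attaches `H`: read the input, copy the reversed input, write the
rows of `H` below a given one, and the two loops that go through the counter. -/
abbrev AttachLabel (H : FinGraph) : Type := Bool ⊕ Fin (H.n + 1) ⊕ Fin H.n ⊕ Fin H.n

/-- Statements of the machine: the stacks are the input, the output, the reversed input, and two
stacks for a counter in unary. -/
abbrev AttachStmt (H : FinGraph) : Type :=
  TM2.Stmt (fun _ : Fin 5 => Option Bool) (AttachLabel H) (Option (Option Bool))

variable {H} in
/-- Push a word, so that its first letter ends up on top. -/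
def pushWord (k : Fin 5) : List (Option Bool) → AttachStmt H → AttachStmt H
  | [], q => q
  | a :: w, q => pushWord k w (push k (fun _ => a) q)

open Classical in
/-- The letter saying whether `y` is in `S`. -/
noncomputable def memLetter (y : Fin H.n) : Option Bool := some (decide (y ∈ S))

/-- The letters that are appended to each row of the given graph. -/
noncomputable def rowTail : List (Option Bool) :=
  (List.finRange H.n).map (memLetter H S) ++ [none]

open Classical in
/-- The row of `H`, with the separator. -/
noncomputable def rowWord (y : Fin H.n) : List (Option Bool) :=
  (List.finRange H.n).map (fun z => some (decide (H.graph.Adj y z))) ++ [none]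

/-- The program of the machine that attaches `H`. -/
noncomputable def attachProgram : AttachLabel H → AttachStmt H
  | .inl false =>
    pop 0 (fun _ x => x) <|
      branch Option.isNone (goto fun _ => .inr (.inl (Fin.last _))) <|
        push 2 (fun v => v.getD none) <|
          branch (fun v => decide (v = some none))
            (push 3 (fun _ => none) (goto fun _ => .inl false)) (goto fun _ => .inl false)
  | .inl true =>
    pop 2 (fun _ x => x) <|
      branch Option.isNone halt <|
        branch (fun v => decide (v = some none))
          (pop 3 (fun v _ => v) (pushWord 1 (rowTail H S) (goto fun _ => .inl true)))
          (push 1 (fun v => v.getD none) (goto fun _ => .inl true))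
  | .inr (.inl j) =>
    Fin.cases (goto fun _ => .inl true)
      (fun y => pushWord 1 (rowWord H y) (goto fun _ => .inr (.inr (.inl y)))) j
  | .inr (.inr (.inl y)) =>
    pop 3 (fun _ x => x) <|
      branch Option.isNone (goto fun _ => .inr (.inr (.inr y))) <|
        push 4 (fun _ => none) (push 1 (fun _ => memLetter H S y)
          (goto fun _ => .inr (.inr (.inl y))))
  | .inr (.inr (.inr y)) =>
    pop 4 (fun _ x => x) <|
      branch Option.isNone (goto fun _ => .inr (.inl y.castSucc)) <|
        push 3 (fun _ => none) (goto fun _ => .inr (.inr (.inr y)))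

/-- The machine that attaches `H`. -/
noncomputable def attachMachine : FinTM2 where
  K := Fin 5
  k₀ := 0
  k₁ := 1
  Γ _ := Option Bool
  Λ := AttachLabel H
  main := .inl false
  σ := Option (Option Bool)
  initialState := none
  m := attachProgram H S

/-- Configurations of the machine. -/
abbrev AttachCfg (H : FinGraph) : Type :=
  TM2.Cfg (fun _ : Fin 5 => Option Bool) (AttachLabel H) (Option (Option Bool))

variable {H} in
/-- The configuration with given contents of the stacks. -/
def attachCfg (l : Option (AttachLabel H)) (v : Option (Option Bool))
    (inp out rev cnt cnt' : List (Option Bool)) : AttachCfg H :=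
  ⟨l, v, ![inp, out, rev, cnt, cnt']⟩

/-- The machine goes from one configuration to another in exactly `m` steps. -/
def RunsIn (m : ℕ) (a b : AttachCfg H) : Prop :=
  (flip bind (TM2.step (attachProgram H S)))^[m] (some a) = some b

variable {H S}

theorem RunsIn.trans {m m' : ℕ} {a b c : AttachCfg H} (h : RunsIn H S m a b)
    (h' : RunsIn H S m' b c) : RunsIn H S (m + m') a c := by
  unfold RunsIn at *
  rw [Nat.add_comm, Function.iterate_add_apply, h, h']

theorem RunsIn.head {m : ℕ} {a b c : AttachCfg H}
    (h : TM2.step (attachProgram H S) a = some b) (h' : RunsIn H S m b c) :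
    RunsIn H S (m + 1) a c := by
  unfold RunsIn at *
  rw [Function.iterate_succ_apply]
  exact (congrArg _ h).trans h'

theorem RunsIn.single {a b : AttachCfg H}
    (h : TM2.step (attachProgram H S) a = some b) : RunsIn H S 1 a b :=
  RunsIn.head (m := 0) h rfl

section Update

variable {X : Type} (a b c d e x : X)

theorem update_vec0 : Function.update ![a, b, c, d, e] 0 x = ![x, b, c, d, e] := by
  funext k; fin_cases k <;> rfl

theorem update_vec1 : Function.update ![a, b, c, d, e] 1 x = ![a, x, c, d, e] := by
  funext k; fin_cases k <;> rfl

theorem update_vec2 : Function.update ![a, b, c, d, e] 2 x = ![a, b, x, d, e] := by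
  funext k; fin_cases k <;> rfl

theorem update_vec3 : Function.update ![a, b, c, d, e] 3 x = ![a, b, c, x, e] := by
  funext k; fin_cases k <;> rfl

theorem update_vec4 : Function.update ![a, b, c, d, e] 4 x = ![a, b, c, d, x] := by
  funext k; fin_cases k <;> rfl

end Update

theorem stepAux_pushWord (k : Fin 5) (w : List (Option Bool)) (q : AttachStmt H)
    (v : Option (Option Bool)) (stk : Fin 5 → List (Option Bool)) :
    TM2.stepAux (pushWord k w q) v stk =
      TM2.stepAux q v (Function.update stk k (w ++ stk k)) := by
  induction w generalizing q with
  | nil => simp [pushWord]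
  | cons a w ih => simp [pushWord, ih]

/-- One counter symbol is stored per separator; on an encoded graph the counter thus holds the
number of vertices. -/
theorem runsIn_read (l : List (Option Bool)) (v : Option (Option Bool))
    (out rev cnt cnt' : List (Option Bool)) :
    RunsIn H S (l.length + 1) (attachCfg (some (.inl false)) v l out rev cnt cnt')
      (attachCfg (some (.inr (.inl (Fin.last _)))) none [] out (l.reverse ++ rev)
        (List.replicate (l.count none) none ++ cnt) cnt') := by
  induction l generalizing v rev cnt with
  | nil =>
    refine RunsIn.single ?_
    simp [attachCfg, attachProgram, update_vec0]
  | cons x l ih =>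
    rcases x with _ | x
    · refine RunsIn.head (b := attachCfg (some (.inl false)) (some none) l out (none :: rev)
        (none :: cnt) cnt') ?_ ?_
      · simp [attachCfg, attachProgram, update_vec0, update_vec2, update_vec3]
      · convert ih (some none) (none :: rev) (none :: cnt) using 2 <;>
          simp [List.replicate_succ']
    · refine RunsIn.head (b := attachCfg (some (.inl false)) (some (some x)) l out
        (some x :: rev) cnt cnt') ?_ ?_
      · simp [attachCfg, attachProgram, update_vec0, update_vec2]
      · convert ih (some (some x)) (some x :: rev) cnt using 2 <;> simp

theorem runsIn_restore (y : Fin H.n) (k : ℕ) (v : Option (Option Bool))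
    (out rev cnt : List (Option Bool)) :
    RunsIn H S (k + 1)
      (attachCfg (some (.inr (.inr (.inr y)))) v [] out rev cnt (List.replicate k none))
      (attachCfg (some (.inr (.inl y.castSucc))) none [] out rev
        (List.replicate k none ++ cnt) []) := by
  induction k generalizing v cnt with
  | zero =>
    refine RunsIn.single ?_
    simp [attachCfg, attachProgram, update_vec4]
  | succ k ih =>
    refine RunsIn.head (b := attachCfg (some (.inr (.inr (.inr y)))) (some none) [] out rev
      (none :: cnt) (List.replicate k none)) ?_ ?_
    · simp [attachCfg, attachProgram, update_vec3, update_vec4, List.replicate_succ]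
    · convert ih (some none) (none :: cnt) using 2
      simp [List.replicate_succ']

theorem runsIn_move (y : Fin H.n) (k : ℕ) (v : Option (Option Bool))
    (out rev cnt' : List (Option Bool)) :
    RunsIn H S (k + 1)
      (attachCfg (some (.inr (.inr (.inl y)))) v [] out rev (List.replicate k none) cnt')
      (attachCfg (some (.inr (.inr (.inr y)))) none []
        (List.replicate k (memLetter H S y) ++ out) rev [] (List.replicate k none ++ cnt')) := by
  induction k generalizing v out cnt' with
  | zero =>
    refine RunsIn.single ?_
    simp [attachCfg, attachProgram, update_vec3]
  | succ k ih =>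
    refine RunsIn.head (b := attachCfg (some (.inr (.inr (.inl y)))) (some none) []
      (memLetter H S y :: out) rev (List.replicate k none) (none :: cnt')) ?_ ?_
    · simp [attachCfg, attachProgram, update_vec1, update_vec3, update_vec4, List.replicate_succ]
    · convert ih (some none) (memLetter H S y :: out) (none :: cnt') using 2
      · simp [List.replicate_succ']
      · simp [List.replicate_succ']

/-- The output is a stack, so the rows of `H` are written from the last to the first. Each takes one
step for its own word and `k + 1` steps each for moving the counter away, writing the adjacencies to
`G`, and for restoring it. -/
theorem runsIn_rows (k j : ℕ) (hj : j < H.n + 1) (out rev : List (Option Bool)) :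
    RunsIn H S (j * (2 * k + 3) + 1)
      (attachCfg (some (.inr (.inl ⟨j, hj⟩))) none [] out rev (List.replicate k none) [])
      (attachCfg (some (.inl true)) none []
        (((List.finRange H.n).take j).flatMap
          (fun y => List.replicate k (memLetter H S y) ++ rowWord H y) ++ out) rev
        (List.replicate k none) []) := by
  induction j generalizing out with
  | zero =>
    rw [Nat.zero_mul]
    refine RunsIn.single ?_
    simp [attachCfg, attachProgram]
  | succ j ih =>
    have hj' : j < H.n := Nat.lt_of_succ_lt_succ hj
    have h1 : RunsIn H S 1
        (attachCfg (some (.inr (.inl ⟨j + 1, hj⟩))) none [] out rev (List.replicate k none) [])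
        (attachCfg (some (.inr (.inr (.inl ⟨j, hj'⟩)))) none [] (rowWord H ⟨j, hj'⟩ ++ out) rev
          (List.replicate k none) []) := by
      refine RunsIn.single ?_
      have : (⟨j + 1, hj⟩ : Fin (H.n + 1)) = Fin.succ ⟨j, hj'⟩ := rfl
      rw [this]
      simp [attachCfg, attachProgram, stepAux_pushWord, update_vec1]
    have h2 := runsIn_move (S := S) ⟨j, hj'⟩ k none (rowWord H ⟨j, hj'⟩ ++ out) rev []
    rw [List.append_nil] at h2
    have h3 := runsIn_restore (S := S) ⟨j, hj'⟩ k none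
      (List.replicate k (memLetter H S ⟨j, hj'⟩) ++ (rowWord H ⟨j, hj'⟩ ++ out)) rev []
    rw [List.append_nil] at h3
    have h4 := ih (Nat.lt_succ_of_lt hj')
      (List.replicate k (memLetter H S ⟨j, hj'⟩) ++ (rowWord H ⟨j, hj'⟩ ++ out))
    have htake : (List.finRange H.n).take (j + 1) =
        (List.finRange H.n).take j ++ [⟨j, hj'⟩] := by
      rw [List.take_succ_eq_append_getElem (by simpa using hj')]
      simp
    have htime : (j + 1) * (2 * k + 3) + 1 = 1 + (k + 1 + (k + 1 + (j * (2 * k + 3) + 1))) := by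
      ring
    rw [htake, htime]
    simpa using h1.trans (h2.trans (h3.trans h4))

variable (H S) in
/-- What the machine writes for a letter of the input. -/
noncomputable def letterWord : Option Bool → List (Option Bool)
  | none => rowTail H S
  | some b => [some b]

/-- Each separator also removes one counter symbol, so all stacks but the output are empty at the
end, as `haltList` demands. -/
theorem runsIn_copy (r : List (Option Bool)) (v : Option (Option Bool))
    (out : List (Option Bool)) :
    RunsIn H S (r.length + 1)
      (attachCfg (some (.inl true)) v [] out r (List.replicate (r.count none) none) [])
      (attachCfg none none [] (r.reverse.flatMap (letterWord H S) ++ out) [] [] []) := by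
  induction r generalizing v out with
  | nil =>
    refine RunsIn.single ?_
    simp [attachCfg, attachProgram, update_vec2]
  | cons x r ih =>
    rcases x with _ | x
    · refine RunsIn.head (b := attachCfg (some (.inl true)) (some none) [] (rowTail H S ++ out) r
        (List.replicate (r.count none) none) []) ?_ ?_
      · simp [attachCfg, attachProgram, stepAux_pushWord, update_vec1, update_vec2, update_vec3,
          List.replicate_succ]
      · convert ih (some none) (rowTail H S ++ out) using 2 <;> simp [letterWord]
    · refine RunsIn.head (b := attachCfg (some (.inl true)) (some (some x)) [] (some x :: out) r
        (List.replicate (r.count none) none) []) ?_ ?_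
      · simp [attachCfg, attachProgram, update_vec1, update_vec2]
      · convert ih (some (some x)) (some x :: out) using 2 <;> simp [letterWord]

theorem runsIn_attach (l : List (Option Bool)) :
    RunsIn H S ((2 * l.length + 3) + H.n * (2 * l.count none + 3))
      (attachCfg (some (.inl false)) none l [] [] [] [])
      (attachCfg none none [] (l.flatMap (letterWord H S) ++ (List.finRange H.n).flatMap
        fun y => List.replicate (l.count none) (memLetter H S y) ++ rowWord H y) [] [] []) := by
  have h1 := runsIn_read (S := S) l none [] [] [] []
  have h2 := runsIn_rows (S := S) (l.count none) H.n (Nat.lt_succ_self _) [] l.reverse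
  have h3 := runsIn_copy (S := S) l.reverse none ((List.finRange H.n).flatMap
        fun y => List.replicate (l.count none) (memLetter H S y) ++ rowWord H y)
  rw [List.append_nil, List.append_nil] at h1
  rw [List.take_of_length_le (by simp), List.append_nil] at h2
  rw [List.count_reverse, List.reverse_reverse] at h3
  have htime : (2 * l.length + 3) + H.n * (2 * l.count none + 3) =
      (l.length + 1) + ((H.n * (2 * l.count none + 3) + 1) + (l.reverse.length + 1)) := by
    rw [List.length_reverse]
    ring
  rw [htime]
  exact h1.trans (h2.trans h3)

open Classical in
theorem count_none_encode (G : FinGraph) : G.encode.count none = G.n := by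
  have h : ∀ (l : List (Fin G.n)) (i : Fin G.n),
      (l.map fun j => some (decide (G.graph.Adj i j))).count none = 0 := by
    intro l i
    simp [List.count_eq_zero]
  simp [encode, List.count_flatMap, Function.comp_def, h]

theorem finRange_add (m n : ℕ) : List.finRange (m + n) =
    (List.finRange m).map (Fin.castAdd n) ++ (List.finRange n).map (Fin.natAdd m) := by
  rw [← List.ofFn_id, List.ofFn_add, List.ofFn_eq_map, List.ofFn_eq_map]
  rfl

/-- In block form, every row of `G` is extended by the indicator of `S`, and the row of a vertex `y`
of `H` is preceded by `G.n` equal letters saying whether `y ∈ S`. -/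
theorem encode_attach (G : FinGraph) : (attach H S G).encode =
    G.encode.flatMap (letterWord H S) ++ (List.finRange H.n).flatMap
      fun y => List.replicate G.n (memLetter H S y) ++ rowWord H y := by
  classical
  have h1 : ∀ i, letterWord H S (some i) = [some i] := fun _ => rfl
  have h2 : letterWord H S none = rowTail H S := rfl
  have hrow : ∀ l : List (Option Bool), (∀ x ∈ l, x ≠ none) → l.flatMap (letterWord H S) = l := by
    intro l hl
    induction l with
    | nil => rfl
    | cons x l ih =>
      rcases x with _ | x
      · exact absurd rfl (hl none (by simp))
      · rw [List.flatMap_cons, h1, ih fun y hy => hl y (List.mem_cons_of_mem _ hy)]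
        rfl
  have hG : G.encode.flatMap (letterWord H S) = (List.finRange G.n).flatMap fun i =>
      (List.finRange G.n).map (fun j => some (decide (G.graph.Adj i j))) ++ rowTail H S := by
    rw [encode, List.flatMap_assoc]
    congr 1
    funext i
    rw [List.flatMap_append, hrow _ (by simp)]
    simp [h2]
  obtain ⟨R, hR⟩ : ∃ R : SimpleGraph (Fin (G.n + H.n)),
      R = (attachAux G.graph H.graph S).comap finSumFinEquiv.symm := ⟨_, rfl⟩
  have hattach : attach H S G = ⟨G.n + H.n, R⟩ := by
    rw [hR]
    rfl
  rw [hG, hattach, encode]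
  dsimp only
  rw [finRange_add, List.flatMap_append, List.flatMap_map, List.flatMap_map]
  have hll : ∀ i j, R.Adj (Fin.castAdd H.n i) (Fin.castAdd H.n j) ↔
      G.graph.Adj i j := by
    intro i j
    simp [hR, attachAux]
  have hlr : ∀ i j, R.Adj (Fin.castAdd H.n i) (Fin.natAdd G.n j) ↔
      j ∈ S := by
    intro i j
    simp [hR, attachAux]
  have hrl : ∀ i j, R.Adj (Fin.natAdd G.n i) (Fin.castAdd H.n j) ↔
      i ∈ S := by
    intro i j
    simp [hR, attachAux]
  have hrr : ∀ i j, R.Adj (Fin.natAdd G.n i) (Fin.natAdd G.n j) ↔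
      H.graph.Adj i j := by
    intro i j
    simp [hR, attachAux]
  congr 1
  · congr 1
    funext i
    simp only [List.map_append, List.map_map, Function.comp_def, List.append_assoc, rowTail]
    congr 2
    · funext j
      exact congrArg some (decide_eq_decide.2 (hll i j))
    · congr 1
      funext j
      exact congrArg some (decide_eq_decide.2 (hlr i j))
  · congr 1
    funext i
    simp only [List.map_append, List.map_map, Function.comp_def, List.append_assoc, rowWord]
    congr 1
    · have : (fun j => some (decide (R.Adj (Fin.natAdd G.n i)
          (Fin.castAdd H.n j)))) = fun _ => memLetter H S i :=
        funext fun j => congrArg some (decide_eq_decide.2 (hrl i j))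
      rw [this]
      simp
    · congr 1
      congr 1
      funext j
      exact congrArg some (decide_eq_decide.2 (hrr i j))

theorem initList_attachMachine (l : List (Option Bool)) :
    initList (attachMachine H S) l = attachCfg (some (.inl false)) none l [] [] [] [] := by
  unfold initList attachCfg
  congr 1
  funext k
  change Fin 5 at k
  fin_cases k <;> rfl

theorem haltList_attachMachine (l : List (Option Bool)) :
    haltList (attachMachine H S) l = attachCfg none none [] l [] [] [] := by
  unfold haltList attachCfg
  congr 1
  funext k
  change Fin 5 at k
  fin_cases k <;> rfl

end Machine

/-- Attaching a fixed graph can be done in polynomial time. -/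
theorem attach_polyTime (H : FinGraph) (S : Set (Fin H.n)) :
    Nonempty (TM2ComputableInPolyTime encode encode (attach H S)) :=
  ⟨{  tm := attachMachine H S
      inputAlphabet := Equiv.refl _
      outputAlphabet := Equiv.refl _
      time := Polynomial.C (H.n + 1) * (2 * Polynomial.X + 3)
      outputsFun := fun G =>
        { steps := (2 * G.encode.length + 3) + H.n * (2 * G.n + 3)
          evals_in_steps := by
            have h := runsIn_attach (H := H) (S := S) G.encode
            rw [count_none_encode, ← encode_attach, ← initList_attachMachine (S := S),
              ← haltList_attachMachine (S := S)] at h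
            have hmap : ∀ l : List (Option Bool), List.map (Equiv.refl (Option Bool)).invFun l = l :=
              fun l => List.map_id l
            exact (congrArg (fun l : List (Option Bool) =>
              (flip bind (TM2.step (attachProgram H S)))^[(2 * G.encode.length + 3) +
                H.n * (2 * G.n + 3)] (some (initList (attachMachine H S) l))) (hmap _)).trans
              (Eq.trans h (congrArg (fun l : List (Option Bool) =>
                some (haltList (attachMachine H S) l)) (hmap _).symm))
          steps_le_m := by
            -- The vertices of `G` correspond to separators, so their number is at most the input
            -- length.
            have h := List.count_le_length (a := none) (l := G.encode)
            rw [count_none_encode] at h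
            simp only [Polynomial.eval_mul, Polynomial.eval_C, Polynomial.eval_add,
              Polynomial.eval_ofNat, Polynomial.eval_X]
            calc 2 * G.encode.length + 3 + H.n * (2 * G.n + 3)
                ≤ 2 * G.encode.length + 3 + H.n * (2 * G.encode.length + 3) := by gcongr
              _ = (H.n + 1) * (2 * G.encode.length + 3) := by ring } }⟩

end FinGraph

theorem theorem1 (A B : GraphProperty)
    (hA : A.IsAdditiveInducedHereditary) (hB : B.IsAdditiveInducedHereditary) :
    ∃ (k l : ℕ) (P : Fin k → GraphProperty) (Q : Fin l → GraphProperty)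
      (H : FinGraph) (c : Fin H.n → Fin k ⊕ Fin l) (v : Fin H.n),
      (∀ i, (P i).IsIrreducible) ∧ (∀ j, (Q j).IsIrreducible) ∧
      A = GraphProperty.prodFamily P ∧ B = GraphProperty.prodFamily Q ∧
      GraphProperty.IsStronglyUniquePartition (Sum.elim P Q) H.graph c ∧
      Function.Surjective c ∧ (c v).isLeft = true ∧
      IsPolyTimeTransformation
        (FinGraph.attach H {u | H.graph.Adj v u ∧ (c u).isRight = true}) A (A.prod B) := by
  obtain ⟨k, l, P, Q, H, c, v, hP, hQ, hA', hB', hH, hc, hv, h⟩ :=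
    exists_reduction_graph A B hA hB
  exact ⟨k, l, P, Q, H, c, v, hP, hQ, hA', hB', hH, hc, hv, FinGraph.attach_polyTime H _, h⟩
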